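/- Let $\ell>0$ and $\alpha\in[1,2)$, and put $\nu_\alpha=\frac{\alpha-1}{2-\alpha}$, $\kappa_\alpha=\frac{2-\alpha}{2}$. For $\nu\ge 0$ let $J_\nu(y)=\sum_{m\ge 0}\frac{(-1)^m}{m!\,\Gamma(m+\nu+1)}\left(\frac y2\right)^{2m+\nu}$, $y\ge 0$, be the Bessel function of the first kind of order $\nu$. The positive zeros of $J_{\nu_\alpha}$ form a strictly increasing infinite sequence $0<j_{\nu_\alpha,1}<j_{\nu_\alpha,2}<\cdots$. Consider the eigenvalue problem $$-(x^\alpha\Phi'(x))'=\lambda\,\Phi(x)\quad (0<x<\ell),\qquad (x^\alpha\Phi')(0)=0,\qquad \Phi(\ell)=0,$$ where $\lambda\in\mathbb R$ and $\Phi\neq 0$ is a real-valued function in $L^2(0,\ell)$ which is locally absolutely continuous in $(0,\ell]$ and satisfies $x^{\alpha/2}\Phi'\in L^2(0,\ell)$ and $x^\alpha\Phi'\in H^1(0,\ell)$. Then: (i) the set of eigenvalues $\lambda$ of this problem is exactly $\{\lambda_{\alpha,n} : n\ge 1\}$, where $\lambda_{\alpha,n}=\ell^{\alpha-2}\kappa_\alpha^2\,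 j_{\nu_\alpha,n}^2$; (ii) for every $n\ge 1$, the function $$\Phi_{\alpha,n}(x)=\frac{\sqrt{2\kappa_\alpha}}{\ell^{\kappa_\alpha}\,|J_{\nu_\alpha}'(j_{\nu_\alpha,n})|}\;x^{(1-\alpha)/2}\,J_{\nu_\alpha}\!\left(j_{\nu_\alpha,n}\Big(\frac x\ell\Big)^{\kappa_\alpha}\right)$$ is an eigenfunction for $\lambda_{\alpha,n}$ with $\|\Phi_{\alpha,n}\|_{L^2(0,\ell)}=1$, and the only eigenfunctions for $\lambda_{\alpha,n}$ of norm $1$ in $L^2(0,\ell)$ are $\Phi_{\alpha,n}$ and $-\Phi_{\alpha,n}$; (iii) the family $(\Phi_{\alpha,n})_{n\ge 1}$ is an orthonormal basis of $L^2(0,\ell)$. -/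

import Mathlib

noncomputable section

/-- Bessel function of the first kind of order `ν`, for `ν ≥ 0` and `y ≥ 0`:
`J_ν(y) = ∑ (-1)^m / (m! Γ(m + ν + 1)) (y/2)^(2m + ν)`. -/
def besselJ (ν y : ℝ) : ℝ :=
  ∑' m : ℕ, (-1 : ℝ) ^ m / ((m.factorial : ℝ) * Real.Gamma ((m : ℝ) + ν + 1)) *
    (y / 2) ^ (2 * (m : ℝ) + ν)

/-- For `n ≥ 1`, `besselZero ν n` is the `n`-th positive zero `j_{ν,n}` of `J_ν`: the smallest zero
that exceeds the previous one. The value `0` at `n = 0` only starts the recursion. -/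
def besselZero (ν : ℝ) : ℕ → ℝ
  | 0 => 0
  | n + 1 => sInf {y : ℝ | besselZero ν n < y ∧ besselJ ν y = 0}

/-- `ν_α = (α - 1) / (2 - α)`. -/
def nuOf (α : ℝ) : ℝ := (α - 1) / (2 - α)

/-- `κ_α = (2 - α) / 2`. -/
def kappaOf (α : ℝ) : ℝ := (2 - α) / 2

/-- Lebesgue measure on `(0, ℓ)`. -/
abbrev intervalMeasure (ℓ : ℝ) : MeasureTheory.Measure ℝ :=
  MeasureTheory.volume.restrict (Set.Ioo 0 ℓ)

/-- `v ∈ H¹(0, ℓ)`: up to a null set, `v` is an absolutely continuous function on `[0, ℓ]` with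
derivative in `L²(0, ℓ)`. -/
def MemH1 (ℓ : ℝ) (v : ℝ → ℝ) : Prop :=
  ∃ w : ℝ → ℝ, AbsolutelyContinuousOnInterval w 0 ℓ ∧ v =ᵐ[intervalMeasure ℓ] w ∧
    MeasureTheory.MemLp (deriv w) 2 (intervalMeasure ℓ)

/-- The weighted Sobolev space `H¹_α(0, ℓ)`: `u ∈ L²(0, ℓ)`, `u` is locally absolutely continuous in
`(0, ℓ]`, and `x^(α/2) u' ∈ L²(0, ℓ)`. -/
structure MemH1Weighted (α ℓ : ℝ) (u : ℝ → ℝ) : Prop where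
  memLp : MeasureTheory.MemLp u 2 (intervalMeasure ℓ)
  locallyAC : ∀ ε ∈ Set.Ioo 0 ℓ, AbsolutelyContinuousOnInterval u ε ℓ
  weightedDeriv : MeasureTheory.MemLp (fun x => x ^ (α / 2) * deriv u x) 2 (intervalMeasure ℓ)

/-- The domain of the operator `A u = (x^α u')'`: `u ∈ H¹_α(0, ℓ)`, `u(ℓ) = 0` and
`x^α u' ∈ H¹(0, ℓ)`. -/
structure MemDomain (α ℓ : ℝ) (u : ℝ → ℝ) : Prop where
  memH1Weighted : MemH1Weighted α ℓ u
  dirichlet : u ℓ = 0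
  flux : MemH1 ℓ (fun x => x ^ α * deriv u x)

/-- `Φ` is an eigenfunction, with eigenvalue `lam`, of the problem
`-(x^α Φ')' = lam Φ` in `(0, ℓ)`, `(x^α Φ')(0) = 0`, `Φ(ℓ) = 0`. (For `Φ` in the domain, `x^α Φ'`
is continuous on `(0, ℓ)`, and its value at `0` is its limit from the right.) -/
structure IsEigenfunction (α ℓ lam : ℝ) (Φ : ℝ → ℝ) : Prop where
  memDomain : MemDomain α ℓ Φ
  ne_zero : ¬ Φ =ᵐ[intervalMeasure ℓ] 0
  equation : ∀ᵐ x ∂(intervalMeasure ℓ), -deriv (fun y => y ^ α * deriv Φ y) x = lam * Φ x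
  neumann : Filter.Tendsto (fun x => x ^ α * deriv Φ x) (nhdsWithin 0 (Set.Ioi 0)) (nhds 0)
  dirichlet : Φ ℓ = 0

/-- `lam` is an eigenvalue of the problem. -/
def IsEigenvalue (α ℓ lam : ℝ) : Prop := ∃ Φ : ℝ → ℝ, IsEigenfunction α ℓ lam Φ

/-- `λ_{α,n} = ℓ^(α-2) κ_α² j_{ν_α,n}²`. -/
def besselEigenvalue (α ℓ : ℝ) (n : ℕ) : ℝ :=
  ℓ ^ (α - 2) * kappaOf α ^ 2 * besselZero (nuOf α) n ^ 2

/-- `Φ_{α,n}(x) = √(2κ_α) / (ℓ^κ_α |J'_{ν_α}(j_{ν_α,n})|) x^((1-α)/2) J_{ν_α}(j_{ν_α,n} (x/ℓ)^κ_α)`. -/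
def besselEigenfunction (α ℓ : ℝ) (n : ℕ) (x : ℝ) : ℝ :=
  Real.sqrt (2 * kappaOf α) /
      (ℓ ^ kappaOf α * |deriv (besselJ (nuOf α)) (besselZero (nuOf α) n)|) *
    x ^ ((1 - α) / 2) * besselJ (nuOf α) (besselZero (nuOf α) n * (x / ℓ) ^ kappaOf α)

end

/-! Write `J_ν(y) = (y/2)^ν g_ν(y²/4)` with `g_ν` entire (`besselEntire`). Then `u_λ(x) = g_ν(λ
x^(2-α)/(2-α)²)` (`regularSol`) solves `-(x^α u')' = λu` with zero flux at `0`, for every real `λ`.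

An eigenfunction becomes a classical solution of a first order system
(`IsEigenfunction.exists_isRegularSolution`). Its Wronskian with `u_λ` is constant and tends to `0`
at `0`, so the Cauchy data at `ℓ` are proportional, and uniqueness backwards from `ℓ` gives `Φ = c
u_λ` (`IsRegularSolution.eq_const_mul`). Hence the eigenvalues are the `λ` with `u_λ(ℓ) = 0`. These
are positive because `g_ν > 0` on `(-∞, 0]`, and they correspond to the positive Bessel zeros.
Orthogonality and the norms come from two exact derivatives, a Lagrange identity and a Rellich
identity.

Completeness comes from the Green operator `G = T*T`, where `(Tf)(t) = t^(-α/2) ∫₀ᵗ f` is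
Hilbert–Schmidt. `G` is compact, symmetric and injective, and each of its eigenvectors is a multiple
of some `u_λ` vanishing at `ℓ` (`exists_regularSol_of_greenOperator`), so the spectral theorem
applies. Completeness also shows that there are infinitely many zeros: otherwise every element of
`L²(0, ℓ)` would have a continuous representative. The zeros are simple, hence locally finite, so
the recursion for `besselZero` enumerates them. -/

noncomputable section

/-! ### The entire part of the Bessel function. -/

/-- The `m`-th coefficient of the entire function `z ↦ ∑ (-1)^m / (m! Γ(m + ν + 1)) z^m`. -/
def besselCoeff (ν : ℝ) (m : ℕ) : ℝ :=
  (-1 : ℝ) ^ m / ((m.factorial : ℝ) * Real.Gamma ((m : ℝ) + ν + 1))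

/-- The entire part of the Bessel function: `J_ν(y) = (y/2)^ν * besselEntire ν (y²/4)`. -/
def besselEntire (ν z : ℝ) : ℝ := ∑' m : ℕ, besselCoeff ν m * z ^ m

end

section BesselSeries

variable {ν : ℝ}

theorem gamma_le_gamma_nat_add (hν : 0 ≤ ν) (m : ℕ) :
    Real.Gamma (ν + 1) ≤ Real.Gamma ((m : ℝ) + ν + 1) := by
  induction m with
  | zero => simp
  | succ m ih =>
    have h : ((m + 1 : ℕ) : ℝ) + ν + 1 = ((m : ℝ) + ν + 1) + 1 := by push_cast; ring
    have hm : (0 : ℝ) ≤ m := Nat.cast_nonneg m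
    rw [h, Real.Gamma_add_one (s := (m : ℝ) + ν + 1) (by positivity)]
    have := Real.Gamma_pos_of_pos (show 0 < (m : ℝ) + ν + 1 by positivity)
    nlinarith

theorem abs_besselCoeff_le (hν : 0 ≤ ν) (m : ℕ) :
    |besselCoeff ν m| ≤ (Real.Gamma (ν + 1))⁻¹ * (1 / (m.factorial : ℝ)) := by
  have h0 : 0 < Real.Gamma (ν + 1) := Real.Gamma_pos_of_pos (by positivity)
  have h1 := gamma_le_gamma_nat_add hν m
  have hf : (0 : ℝ) < m.factorial := by positivity
  rw [besselCoeff, abs_div, abs_pow, abs_neg, abs_one, one_pow,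
    abs_of_pos (mul_pos hf (h0.trans_le h1)), ← one_div, one_div_mul_one_div, mul_comm]
  gcongr

theorem summable_abs_besselCoeff_mul_pow (hν : 0 ≤ ν) (R : ℝ) :
    Summable fun m : ℕ => |besselCoeff ν m| * |R| ^ m := by
  refine Summable.of_nonneg_of_le (fun m => by positivity) (fun m => ?_)
    ((Real.summable_pow_div_factorial |R|).mul_left (Real.Gamma (ν + 1))⁻¹)
  calc |besselCoeff ν m| * |R| ^ m
      ≤ ((Real.Gamma (ν + 1))⁻¹ * (1 / (m.factorial : ℝ))) * |R| ^ m := by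
        gcongr; exact abs_besselCoeff_le hν m
    _ = _ := by ring

theorem summable_besselCoeff_mul_pow (hν : 0 ≤ ν) (z : ℝ) :
    Summable fun m : ℕ => besselCoeff ν m * z ^ m := by
  refine Summable.of_norm ?_
  simpa [abs_mul] using summable_abs_besselCoeff_mul_pow hν z

theorem besselCoeff_succ_mul (ν : ℝ) (m : ℕ) :
    besselCoeff ν (m + 1) * ((m + 1 : ℕ) : ℝ) = -besselCoeff (ν + 1) m := by
  have h : ((m + 1 : ℕ) : ℝ) + ν + 1 = (m : ℝ) + (ν + 1) + 1 := by push_cast; ring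
  have hm : ((m : ℝ) + 1) ≠ 0 := by positivity
  rw [besselCoeff, besselCoeff, h, Nat.factorial_succ, pow_succ]
  push_cast
  rw [mul_assoc, ← div_div, div_mul_eq_mul_div, div_mul_cancel₀ _ hm]
  ring

/-- Termwise differentiation on a ball: the coefficient shift `besselCoeff_succ_mul` turns the
derivative series into that of `-g_{ν+1}` and makes its majorant summable. -/
theorem hasDerivAt_besselEntire (hν : 0 ≤ ν) (z : ℝ) :
    HasDerivAt (besselEntire ν) (-besselEntire (ν + 1) z) z := by
  set R : ℝ := |z| + 1
  have hR : |R| = R := abs_of_pos (by positivity)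
  have hz : z ∈ Metric.ball (0 : ℝ) R := by simp [R]
  have key := hasDerivAt_tsum_of_isPreconnected
    (g := fun (m : ℕ) z => besselCoeff ν m * z ^ m)
    (g' := fun (m : ℕ) z => besselCoeff ν m * (m * z ^ (m - 1)))
    (u := fun m : ℕ => |besselCoeff ν m * m| * R ^ (m - 1)) (t := Metric.ball (0 : ℝ) R)
    (y₀ := z) (y := z) ?_ Metric.isOpen_ball (convex_ball _ _).isPreconnected ?_ ?_ hz
    (summable_besselCoeff_mul_pow hν z) hz
  · have hs : Summable fun m : ℕ => besselCoeff ν m * (m * z ^ (m - 1)) := by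
      rw [← summable_nat_add_iff 1]
      refine ((summable_besselCoeff_mul_pow (ν := ν + 1) (by positivity) z).neg).congr fun m => ?_
      rw [← mul_assoc, besselCoeff_succ_mul]; simp
    refine key.congr_deriv ?_
    rw [hs.tsum_eq_zero_add, besselEntire, ← tsum_neg]
    simp only [CharP.cast_eq_zero, zero_mul, mul_zero, zero_add]
    refine tsum_congr fun m => ?_
    rw [← mul_assoc, besselCoeff_succ_mul]; simp
  · rw [← summable_nat_add_iff 1]
    refine (summable_abs_besselCoeff_mul_pow (ν := ν + 1) (by positivity) R).congr fun m => ?_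
    rw [besselCoeff_succ_mul, abs_neg, hR]; simp
  · intro m y _
    exact (hasDerivAt_pow m y).const_mul _
  · intro m y hy
    rw [mem_ball_zero_iff] at hy
    rw [← mul_assoc, norm_mul, norm_pow, Real.norm_eq_abs (_ * _)]
    gcongr

theorem continuous_besselEntire (hν : 0 ≤ ν) : Continuous (besselEntire ν) :=
  continuous_iff_continuousAt.2 fun z => (hasDerivAt_besselEntire hν z).continuousAt

/-- The contiguous relation `z g_{ν+2} - (ν+1) g_{ν+1} + g_ν = 0`. -/
theorem besselEntire_contiguous (hν : 0 ≤ ν) (z : ℝ) :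
    z * besselEntire (ν + 2) z = (ν + 1) * besselEntire (ν + 1) z - besselEntire ν z := by
  have s0 := summable_besselCoeff_mul_pow hν z
  have s1 := summable_besselCoeff_mul_pow (ν := ν + 1) (by positivity) z
  have s2 := summable_besselCoeff_mul_pow (ν := ν + 2) (by positivity) z
  have hd : Summable fun m : ℕ => (ν + 1) * (besselCoeff (ν + 1) m * z ^ m)
      - besselCoeff ν m * z ^ m := (s1.mul_left _).sub s0
  rw [besselEntire, besselEntire, besselEntire, ← tsum_mul_left, ← tsum_mul_left,
    ← (s1.mul_left _).tsum_sub s0, hd.tsum_eq_zero_add]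
  have hg : ∀ m : ℕ, Real.Gamma ((m : ℝ) + (ν + 1) + 1)
      = ((m : ℝ) + ν + 1) * Real.Gamma ((m : ℝ) + ν + 1) := fun m => by
    rw [← Real.Gamma_add_one (by positivity)]; ring_nf
  -- As `Γ(m+ν+2) = (m+ν+1) Γ(m+ν+1)`, the `m`-th coefficients combine with the factor `(ν+1) -
  -- (m+ν+1) = -m`. The constant term drops out, and the coefficient shift gives the rest.
  have hc : ∀ m : ℕ, (ν + 1) * besselCoeff (ν + 1) m - besselCoeff ν m
      = - (m : ℝ) * besselCoeff (ν + 1) m := fun m => by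
    have h1 := (Real.Gamma_pos_of_pos (show 0 < (m : ℝ) + ν + 1 by positivity)).ne'
    have h2 : (m : ℝ) + ν + 1 ≠ 0 := by positivity
    have h3 : (m.factorial : ℝ) ≠ 0 := by positivity
    rw [besselCoeff, besselCoeff, hg]
    field_simp
    ring
  have hz : ∀ m : ℕ, (ν + 1) * (besselCoeff (ν + 1) m * z ^ m) - besselCoeff ν m * z ^ m
      = - (m : ℝ) * besselCoeff (ν + 1) m * z ^ m := fun m => by
    rw [← hc]; ring
  simp only [hz]
  simp only [CharP.cast_eq_zero, neg_zero, zero_mul, zero_add]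
  refine tsum_congr fun m => ?_
  have := besselCoeff_succ_mul (ν + 1) m
  rw [show ν + 1 + 1 = ν + 2 by ring] at this
  rw [show -((m + 1 : ℕ) : ℝ) * besselCoeff (ν + 1) (m + 1)
    = besselCoeff (ν + 2) m by rw [neg_mul, mul_comm, this, neg_neg], pow_succ]
  ring

theorem besselEntire_zero_pos (hν : 0 ≤ ν) : 0 < besselEntire ν 0 := by
  rw [besselEntire, tsum_eq_single 0 (by intro m hm; simp [hm])]
  simpa [besselCoeff] using Real.Gamma_pos_of_pos (show 0 < ν + 1 by positivity)

/-- Every term is nonnegative since `(-1)^m z^m = (-z)^m`. This rules out eigenvalues `≤ 0`. -/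
theorem besselEntire_pos_of_nonpos (hν : 0 ≤ ν) {z : ℝ} (hz : z ≤ 0) :
    0 < besselEntire ν z := by
  refine (summable_besselCoeff_mul_pow hν z).tsum_pos (fun m => ?_) 0 ?_
  · rw [besselCoeff, div_mul_eq_mul_div, ← mul_pow]
    have := Real.Gamma_pos_of_pos (show 0 < (m : ℝ) + ν + 1 by positivity)
    have h2 : 0 ≤ (-1) * z := by linarith
    positivity
  · simpa [besselCoeff] using Real.Gamma_pos_of_pos (show 0 < ν + 1 by positivity)

theorem besselJ_eq (hν : 0 ≤ ν) {y : ℝ} (hy : 0 ≤ y) :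
    besselJ ν y = (y / 2) ^ ν * besselEntire ν (y ^ 2 / 4) := by
  rw [besselJ, besselEntire, ← tsum_mul_left]
  refine tsum_congr fun m => ?_
  have h : (y / 2) ^ (2 * (m : ℝ) + ν) = (y ^ 2 / 4) ^ m * (y / 2) ^ ν := by
    rw [Real.rpow_add_of_nonneg (by positivity) (by positivity) hν]
    congr 1
    rw [show (2 * (m : ℝ)) = ((2 * m : ℕ) : ℝ) by push_cast; ring, Real.rpow_natCast, pow_mul]
    congr 1; ring
  rw [h, besselCoeff]; ring

theorem besselJ_eq_zero_iff (hν : 0 ≤ ν) {y : ℝ} (hy : 0 < y) :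
    besselJ ν y = 0 ↔ besselEntire ν (y ^ 2 / 4) = 0 := by
  have : (y / 2) ^ ν ≠ 0 := (Real.rpow_pos_of_pos (by positivity) ν).ne'
  rw [besselJ_eq hν hy.le]; simp [this]

/-- At a zero, the product-rule term that differentiates `(y/2)^ν` vanishes. -/
theorem deriv_besselJ_of_eq_zero (hν : 0 ≤ ν) {y : ℝ} (hy : 0 < y) (h : besselJ ν y = 0) :
    deriv (besselJ ν) y = -((y / 2) ^ ν * besselEntire (ν + 1) (y ^ 2 / 4) * (y / 2)) := by
  have hE := (besselJ_eq_zero_iff hν hy).1 h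
  have h1 : besselJ ν =ᶠ[nhds y] fun y => (y / 2) ^ ν * besselEntire ν (y ^ 2 / 4) := by
    filter_upwards [lt_mem_nhds hy] with x hx using besselJ_eq hν hx.le
  have h2 : HasDerivAt (fun y : ℝ => (y / 2) ^ ν) (ν * (y / 2) ^ (ν - 1) * (1 / 2)) y := by
    have := (Real.hasDerivAt_rpow_const (p := ν) (Or.inl (show y / 2 ≠ 0 by positivity))).comp y
      ((hasDerivAt_id y).div_const 2)
    exact this
  have h3 : HasDerivAt (fun y : ℝ => besselEntire ν (y ^ 2 / 4))
      (-besselEntire (ν + 1) (y ^ 2 / 4) * (2 * y / 4)) y := by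
    have := (hasDerivAt_besselEntire hν (y ^ 2 / 4)).comp y (((hasDerivAt_pow 2 y)).div_const 4)
    exact this.congr_deriv (by simp)
  rw [h1.deriv_eq, (h2.fun_mul h3).deriv, hE]
  ring

end BesselSeries

/-! ### Solutions regular at `0` and their uniqueness. -/

noncomputable section

/-- The solution of `-(x^α u')' = lam u` that is regular at `0`. -/
def regularSol (α lam x : ℝ) : ℝ :=
  besselEntire (nuOf α) (lam * x ^ (2 - α) / (2 - α) ^ 2)

/-- The flux `x^α u'` of `regularSol`. -/
def regularFlux (α lam x : ℝ) : ℝ :=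
  x * (-(lam / (2 - α)) * besselEntire (nuOf α + 1) (lam * x ^ (2 - α) / (2 - α) ^ 2))

end

open Set Filter Topology

/-- `(Φ, p)` solves the first order system `x^α Φ' = p`, `p' = -lam Φ` on `(0, ℓ)`, with vanishing
flux at `0`. -/
structure IsRegularSolution (α ℓ lam : ℝ) (Φ p : ℝ → ℝ) : Prop where
  continuousOn : ContinuousOn Φ (Ioc 0 ℓ)
  continuousOn_flux : ContinuousOn p (Icc 0 ℓ)
  flux_zero : p 0 = 0
  hasDerivAt : ∀ x ∈ Ioo 0 ℓ, HasDerivAt Φ (x ^ (-α) * p x) x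
  hasDerivAt_flux : ∀ x ∈ Ioo 0 ℓ, HasDerivAt p (-(lam * Φ x)) x

section RegularSolution

variable {α ℓ lam mu : ℝ} {Φ p Ψ q : ℝ → ℝ}

theorem nuOf_nonneg (hα : α ∈ Ico (1 : ℝ) 2) : 0 ≤ nuOf α :=
  div_nonneg (by linarith [hα.1]) (by linarith [hα.2])

theorem nuOf_add_one (hα : α ∈ Ico (1 : ℝ) 2) : nuOf α + 1 = 1 / (2 - α) := by
  have : 2 - α ≠ 0 := by linarith [hα.2]
  rw [nuOf]; field_simp; ring

theorem continuous_regularArg (hα : α ∈ Ico (1 : ℝ) 2) (lam : ℝ) :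
    Continuous fun x : ℝ => lam * x ^ (2 - α) / (2 - α) ^ 2 :=
  ((Real.continuous_rpow_const (by linarith [hα.2])).const_mul lam).div_const _

theorem continuous_regularSol (hα : α ∈ Ico (1 : ℝ) 2) (lam : ℝ) :
    Continuous (regularSol α lam) :=
  (continuous_besselEntire (nuOf_nonneg hα)).comp (continuous_regularArg hα lam)

theorem continuous_regularFlux (hα : α ∈ Ico (1 : ℝ) 2) (lam : ℝ) :
    Continuous (regularFlux α lam) :=
  continuous_id.mul (continuous_const.mul
    ((continuous_besselEntire (by linarith [nuOf_nonneg hα])).comp (continuous_regularArg hα lam)))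

theorem regularSol_zero (hα : α ∈ Ico (1 : ℝ) 2) (lam : ℝ) :
    0 < regularSol α lam 0 := by
  rw [regularSol, Real.zero_rpow (by linarith [hα.2])]
  simpa using besselEntire_zero_pos (nuOf_nonneg hα)

theorem hasDerivAt_regularArg (lam : ℝ) {x : ℝ} (hx : 0 < x) :
    HasDerivAt (fun x : ℝ => lam * x ^ (2 - α) / (2 - α) ^ 2)
      (lam * ((2 - α) * x ^ (1 - α)) / (2 - α) ^ 2) x := by
  have h := ((Real.hasDerivAt_rpow_const (p := 2 - α) (Or.inl hx.ne')).const_mul lam).div_const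
    ((2 - α) ^ 2)
  rwa [show 2 - α - 1 = 1 - α by ring] at h

theorem hasDerivAt_regularSol (hα : α ∈ Ico (1 : ℝ) 2) (lam : ℝ) {x : ℝ} (hx : 0 < x) :
    HasDerivAt (regularSol α lam) (x ^ (-α) * regularFlux α lam x) x := by
  have h2 : 2 - α ≠ 0 := by linarith [hα.2]
  refine ((hasDerivAt_besselEntire (nuOf_nonneg hα) _).comp x
    (hasDerivAt_regularArg lam hx)).congr_deriv ?_
  rw [regularFlux, show 1 - α = -α + 1 by ring, Real.rpow_add hx, Real.rpow_one]
  field_simp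

/-- The differential equation reduces to `besselEntire_contiguous`, because `ν + 1 = 1 / (2 - α)`.
-/
theorem hasDerivAt_regularFlux (hα : α ∈ Ico (1 : ℝ) 2) (lam : ℝ) {x : ℝ} (hx : 0 < x) :
    HasDerivAt (regularFlux α lam) (-(lam * regularSol α lam x)) x := by
  have h2 : 2 - α ≠ 0 := by linarith [hα.2]
  have hν := nuOf_nonneg hα
  refine ((hasDerivAt_id x).mul (((hasDerivAt_besselEntire (ν := nuOf α + 1) (by linarith) _).comp x
    (hasDerivAt_regularArg lam hx)).const_mul (-(lam / (2 - α))))).congr_deriv ?_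
  have hc := besselEntire_contiguous hν (lam * x ^ (2 - α) / (2 - α) ^ 2)
  have hp : x ^ (1 - α) * x = x ^ (2 - α) := by
    rw [show 2 - α = 1 - α + 1 by ring, Real.rpow_add hx, Real.rpow_one]
  rw [nuOf_add_one hα] at hc
  simp only [regularSol, Function.comp_apply, id, nuOf_add_one hα] at hc ⊢
  rw [show nuOf α + 2 = 1 / (2 - α) + 1 by rw [← nuOf_add_one hα]; ring] at hc
  set A := besselEntire (1 / (2 - α) + 1) (lam * x ^ (2 - α) / (2 - α) ^ 2)
  set B := besselEntire (1 / (2 - α)) (lam * x ^ (2 - α) / (2 - α) ^ 2)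
  set C := besselEntire (nuOf α) (lam * x ^ (2 - α) / (2 - α) ^ 2)
  have hC : C = 1 / (2 - α) * B - lam * x ^ (2 - α) / (2 - α) ^ 2 * A := by linarith
  rw [hC, ← hp]
  field_simp
  ring

theorem isRegularSolution_regularSol (hα : α ∈ Ico (1 : ℝ) 2) (ℓ lam : ℝ) :
    IsRegularSolution α ℓ lam (regularSol α lam) (regularFlux α lam) where
  continuousOn := (continuous_regularSol hα lam).continuousOn
  continuousOn_flux := (continuous_regularFlux hα lam).continuousOn
  flux_zero := by simp [regularFlux]
  hasDerivAt x hx := hasDerivAt_regularSol hα lam hx.1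
  hasDerivAt_flux x hx := hasDerivAt_regularFlux hα lam hx.1

namespace IsRegularSolution

theorem sub_const_mul (h : IsRegularSolution α ℓ lam Φ p) (h' : IsRegularSolution α ℓ lam Ψ q)
    (c : ℝ) : IsRegularSolution α ℓ lam (fun x => Φ x - c * Ψ x) (fun x => p x - c * q x) where
  continuousOn := h.continuousOn.sub (h'.continuousOn.const_mul c)
  continuousOn_flux := h.continuousOn_flux.sub (h'.continuousOn_flux.const_mul c)
  flux_zero := by simp [h.flux_zero, h'.flux_zero]
  hasDerivAt x hx := ((h.hasDerivAt x hx).sub ((h'.hasDerivAt x hx).const_mul c)).congr_deriv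
    (by ring)
  hasDerivAt_flux x hx := ((h.hasDerivAt_flux x hx).sub
    ((h'.hasDerivAt_flux x hx).const_mul c)).congr_deriv (by ring)

/-- A solution with vanishing Cauchy data at `ℓ` vanishes. -/
theorem eq_zero_of_right (h : IsRegularSolution α ℓ lam Φ p) (hα : 0 ≤ α) (h0 : Φ ℓ = 0)
    (h1 : p ℓ = 0) {x : ℝ} (hx : x ∈ Ioc 0 ℓ) : Φ x = 0 := by
  -- Grönwall constant: on `[x, ℓ]` the derivative of `Φ² + p²` is at least `-K (Φ² + p²)`, since
  -- `|y^(-α) - lam| ≤ K`. So `(Φ² + p²) e^(Ky)` increases, and it ends at `0`.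
  set K := x ^ (-α) + |lam|
  have hx0 := hx.1
  have hsub : Icc x ℓ ⊆ Ioc 0 ℓ := fun y hy => ⟨hx0.trans_le hy.1, hy.2⟩
  have hsub' : Ioc 0 ℓ ⊆ Icc 0 ℓ := Ioc_subset_Icc_self
  have hmono : MonotoneOn (fun y => (Φ y ^ 2 + p y ^ 2) * Real.exp (K * y)) (Icc x ℓ) := by
    have hd : ∀ y ∈ Ioo x ℓ, HasDerivAt (fun y => (Φ y ^ 2 + p y ^ 2) * Real.exp (K * y))
        ((2 * Φ y * p y * (y ^ (-α) - lam) + K * (Φ y ^ 2 + p y ^ 2)) * Real.exp (K * y)) y := by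
      intro y hy
      have hy' : y ∈ Ioo 0 ℓ := ⟨hx0.trans hy.1, hy.2⟩
      refine ((((h.hasDerivAt y hy').fun_pow 2).fun_add
        ((h.hasDerivAt_flux y hy').fun_pow 2)).fun_mul
        (((hasDerivAt_id y).const_mul K).exp)).congr_deriv ?_
      simp; ring
    refine monotoneOn_of_deriv_nonneg (convex_Icc _ _) ?_ ?_ ?_
    · exact (((h.continuousOn.mono hsub).pow 2).add
        ((h.continuousOn_flux.mono (hsub.trans hsub')).pow 2)).mul (by fun_prop)
    · rw [interior_Icc]
      exact fun y hy => (hd y hy).differentiableAt.differentiableWithinAt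
    · rw [interior_Icc]
      intro y hy
      rw [(hd y hy).deriv]
      refine mul_nonneg ?_ (Real.exp_pos _).le
      have hy0 : 0 < y := hx0.trans hy.1
      have h3 : y ^ (-α) ≤ x ^ (-α) := Real.rpow_le_rpow_of_nonpos hx0 hy.1.le (by linarith)
      have h4 : 0 ≤ y ^ (-α) := Real.rpow_nonneg hy0.le _
      have h5 : |y ^ (-α) - lam| ≤ K :=
        (abs_sub _ _).trans (add_le_add (by rwa [abs_of_nonneg h4]) le_rfl)
      have h6 : |2 * Φ y * p y| ≤ Φ y ^ 2 + p y ^ 2 := by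
        rw [abs_le]; constructor <;> nlinarith [sq_nonneg (Φ y + p y), sq_nonneg (Φ y - p y)]
      have h7 := neg_abs_le (2 * Φ y * p y * (y ^ (-α) - lam))
      rw [abs_mul] at h7
      have h8 := mul_le_mul h6 h5 (abs_nonneg _) (by positivity)
      linarith
  have := hmono ⟨le_rfl, hx.2⟩ ⟨hx.2, le_rfl⟩ hx.2
  simp only [h0, h1, ne_eq, OfNat.ofNat_ne_zero, not_false_eq_true, zero_pow, add_zero,
    zero_mul] at this
  have h9 : Φ x ^ 2 + p x ^ 2 ≤ 0 := nonpos_of_mul_nonpos_left this (Real.exp_pos _)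
  nlinarith [sq_nonneg (p x), sq_nonneg (Φ x)]

/-- Since `p` is bounded, integrating `Φ' = x^(-α) p` shows that `Φ` grows more slowly than `1/x`,
because `α < 2`. This controls the Wronskian at `0`. -/
theorem tendsto_mul_zero (h : IsRegularSolution α ℓ lam Φ p) (hα : α ∈ Ico (1 : ℝ) 2)
    (hℓ : 0 < ℓ) : Tendsto (fun x => x * Φ x) (𝓝[>] 0) (𝓝 0) := by
  obtain ⟨M, hM⟩ := isCompact_Icc.exists_bound_of_continuousOn h.continuousOn_flux
  have hM0 : 0 ≤ M := (norm_nonneg _).trans (hM 0 ⟨le_rfl, hℓ.le⟩)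
  -- An exponent with `α ≤ β` and `1 < β < 2`. Using `β` in place of `α` avoids the logarithm that
  -- appears at `α = 1`.
  set β := (α + 2) / 2 with hβ
  have hβ1 : 1 < β := by linarith [hα.1]
  have hβα : α ≤ β := by linarith [hα.2]
  have hβ2 : β < 2 := by linarith [hα.2]
  -- Chosen so that `-(C y^(1-β))' = M ℓ^(β-α) y^(-β)`, which dominates `M y^(-α) ≥ |Φ'|`.
  set C := M * ℓ ^ (β - α) / (β - 1) with hC
  have hC0 : 0 ≤ C := div_nonneg (mul_nonneg hM0 (Real.rpow_nonneg hℓ.le _)) (by linarith)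
  have hder : ∀ y ∈ Ioo 0 ℓ, |y ^ (-α) * p y| ≤ C * (β - 1) * y ^ (-β) := by
    intro y hy
    have h1 : C * (β - 1) = M * ℓ ^ (β - α) := div_mul_cancel₀ _ (by linarith)
    have h2 : y ^ (-α) = y ^ (β - α) * y ^ (-β) := by rw [← Real.rpow_add hy.1]; ring_nf
    have h3 : y ^ (β - α) ≤ ℓ ^ (β - α) :=
      Real.rpow_le_rpow hy.1.le hy.2.le (by linarith)
    have h4 := Real.rpow_nonneg hy.1.le (-β)
    have h5 := Real.rpow_nonneg hy.1.le (β - α)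
    have h6 : |p y| ≤ M := hM y (Ioo_subset_Icc_self hy)
    rw [h1, h2, abs_mul, abs_mul, abs_of_nonneg h4, abs_of_nonneg h5]
    calc y ^ (β - α) * y ^ (-β) * |p y| ≤ ℓ ^ (β - α) * y ^ (-β) * M := by gcongr
      _ = _ := by ring
  have hpow : ∀ y ∈ Ioo 0 ℓ, HasDerivAt (fun y => C * y ^ (1 - β)) (-(C * (β - 1) * y ^ (-β))) y :=
    fun y hy => ((Real.hasDerivAt_rpow_const (p := 1 - β) (Or.inl hy.1.ne')).const_mul
      C).congr_deriv (by rw [show 1 - β - 1 = -β by ring]; ring)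
  have hcont : ContinuousOn (fun y => C * y ^ (1 - β)) (Ioc 0 ℓ) := fun y hy =>
    ((Real.continuousAt_rpow_const _ _ (Or.inl hy.1.ne')).const_mul C).continuousWithinAt
  have hanti : ∀ s : ℝ, |s| = 1 → AntitoneOn (fun y => C * y ^ (1 - β) + s * Φ y) (Ioc 0 ℓ) := by
    intro s hs
    have hd := fun y hy => (hpow y hy).fun_add ((h.hasDerivAt y hy).const_mul s)
    refine antitoneOn_of_deriv_nonpos (convex_Ioc _ _) (hcont.add (h.continuousOn.const_mul s))
      ?_ ?_
    · rw [interior_Ioc]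
      exact fun y hy => (hd y hy).differentiableAt.differentiableWithinAt
    · rw [interior_Ioc]
      intro y hy
      rw [(hd y hy).deriv]
      have : s * (y ^ (-α) * p y) ≤ |y ^ (-α) * p y| :=
        (le_abs_self _).trans_eq ((abs_mul s _).trans (by rw [hs, one_mul]))
      linarith [hder y hy]
  have hbound : ∀ x ∈ Ioc 0 ℓ, |Φ x| ≤ C * x ^ (1 - β) + |Φ ℓ| := by
    intro x hx
    have h1 := hanti 1 (by simp) hx ⟨hℓ, le_rfl⟩ hx.2
    have h2 := hanti (-1) (by simp) hx ⟨hℓ, le_rfl⟩ hx.2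
    have h3 : 0 ≤ C * ℓ ^ (1 - β) := mul_nonneg hC0 (Real.rpow_nonneg hℓ.le _)
    simp only at h1 h2
    rw [abs_le]
    constructor <;> linarith [neg_abs_le (Φ ℓ), le_abs_self (Φ ℓ)]
  have hlim : Tendsto (fun x : ℝ => C * x ^ (2 - β) + x * |Φ ℓ|) (𝓝[>] 0) (𝓝 0) := by
    have : Continuous fun x : ℝ => C * x ^ (2 - β) + x * |Φ ℓ| :=
      ((Real.continuous_rpow_const (by linarith)).const_mul C).add (by fun_prop)
    have := this.tendsto 0
    rw [Real.zero_rpow (by linarith)] at this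
    simpa using this.mono_left nhdsWithin_le_nhds
  refine squeeze_zero_norm' ?_ hlim
  filter_upwards [Ioc_mem_nhdsGT hℓ] with x hx
  have h1 : x ^ (2 - β) = x * x ^ (1 - β) := by
    rw [show 2 - β = 1 + (1 - β) by ring, Real.rpow_add hx.1, Real.rpow_one]
  rw [norm_mul, Real.norm_of_nonneg hx.1.le, h1]
  have := mul_le_mul_of_nonneg_left (hbound x hx) hx.1.le
  rw [Real.norm_eq_abs]
  linarith

/-- The Wronskian of two solutions regular at `0` vanishes. -/
theorem wronskian_eq_zero (h : IsRegularSolution α ℓ lam Φ p) (hα : α ∈ Ico (1 : ℝ) 2)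
    (hℓ : 0 < ℓ) : Φ ℓ * regularFlux α lam ℓ - p ℓ * regularSol α lam ℓ = 0 := by
  set W : ℝ → ℝ := fun x => Φ x * regularFlux α lam x - p x * regularSol α lam x with hW
  have hu := isRegularSolution_regularSol hα ℓ lam
  have hconst : ∀ x ∈ Ioo 0 ℓ, W x = W ℓ := by
    intro x hx
    have hsub : Icc x ℓ ⊆ Ioc 0 ℓ := fun y hy => ⟨hx.1.trans_le hy.1, hy.2⟩
    have hsub' : Icc x ℓ ⊆ Icc 0 ℓ := hsub.trans Ioc_subset_Icc_self
    obtain ⟨c, hc, hc'⟩ := exists_hasDerivAt_eq_slope W (fun _ => 0) hx.2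
      (((h.continuousOn.mono hsub).mul (hu.continuousOn_flux.mono hsub')).sub
        ((h.continuousOn_flux.mono hsub').mul (hu.continuousOn.mono hsub))) (fun y hy => by
        have hy' : y ∈ Ioo 0 ℓ := ⟨hx.1.trans hy.1, hy.2⟩
        exact (((h.hasDerivAt y hy').fun_mul (hu.hasDerivAt_flux y hy')).fun_sub
          ((h.hasDerivAt_flux y hy').fun_mul (hu.hasDerivAt y hy'))).congr_deriv (by ring))
    have : ℓ - x ≠ 0 := by linarith [hx.2]
    rw [eq_comm, div_eq_zero_iff, or_iff_left this] at hc'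
    linarith
  have hlim : Tendsto W (𝓝[>] 0) (𝓝 0) := by
    -- `regularFlux` is `x` times this continuous function, so `Φ * regularFlux` is `x * Φ x` times
    -- a bounded factor near `0`.
    have hc : Continuous fun x => -(lam / (2 - α)) *
        besselEntire (nuOf α + 1) (lam * x ^ (2 - α) / (2 - α) ^ 2) :=
      continuous_const.mul ((continuous_besselEntire (ν := nuOf α + 1)
        (by linarith [nuOf_nonneg hα])).comp (continuous_regularArg hα lam))
    have h1 := (h.tendsto_mul_zero hα hℓ).mul ((hc.tendsto 0).mono_left nhdsWithin_le_nhds)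
    have hp : Tendsto p (𝓝[>] 0) (𝓝 0) := by
      have := (h.continuousOn_flux 0 ⟨le_rfl, hℓ.le⟩).tendsto
      rw [h.flux_zero] at this
      refine this.mono_left (nhdsWithin_le_of_mem ?_)
      exact mem_of_superset (Ioc_mem_nhdsGT hℓ) Ioc_subset_Icc_self
    have h2 := hp.mul
      (((continuous_regularSol hα lam).tendsto 0).mono_left nhdsWithin_le_nhds)
    have h3 := h1.sub h2
    simp only [zero_mul, sub_zero] at h3
    refine h3.congr fun x => ?_
    simp only [hW, regularFlux]
    ring
  have hev : W =ᶠ[𝓝[>] 0] fun _ => W ℓ := by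
    filter_upwards [Ioo_mem_nhdsGT hℓ] with x hx using hconst x hx
  exact (tendsto_nhds_unique (hlim.congr' hev) tendsto_const_nhds).symm

end IsRegularSolution

theorem exists_regularSol_ne_zero (hα : α ∈ Ico (1 : ℝ) 2) (hℓ : 0 < ℓ) (lam : ℝ) :
    ∃ x ∈ Ioo 0 ℓ, regularSol α lam x ≠ 0 := by
  have h := ((continuous_regularSol hα lam).continuousAt (x := 0)).eventually_ne
    (regularSol_zero hα lam).ne'
  have h2 := (h.filter_mono nhdsWithin_le_nhds).and (Ioo_mem_nhdsGT hℓ)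
  obtain ⟨x, hx⟩ := h2.exists
  exact ⟨x, hx.2, hx.1⟩

/-- The zeros of `regularSol` at `ℓ` are simple. -/
theorem regularFlux_ne_zero (hα : α ∈ Ico (1 : ℝ) 2) (hℓ : 0 < ℓ)
    (h : regularSol α lam ℓ = 0) : regularFlux α lam ℓ ≠ 0 := by
  intro h1
  obtain ⟨x, hx, hne⟩ := exists_regularSol_ne_zero hα hℓ lam
  exact hne ((isRegularSolution_regularSol hα ℓ lam).eq_zero_of_right (by linarith [hα.1]) h h1
    (Ioo_subset_Ioc_self hx))

theorem regularSol_pos_of_nonpos (hα : α ∈ Ico (1 : ℝ) 2) (hℓ : 0 < ℓ) (h : lam ≤ 0) :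
    0 < regularSol α lam ℓ := by
  have := Real.rpow_nonneg hℓ.le (2 - α)
  exact besselEntire_pos_of_nonpos (nuOf_nonneg hα)
    (div_nonpos_of_nonpos_of_nonneg (mul_nonpos_of_nonpos_of_nonneg h this) (sq_nonneg _))

/-- A nonzero regular solution vanishing at `ℓ` is a multiple of `regularSol`, which then vanishes
at `ℓ`. -/
theorem IsRegularSolution.eq_const_mul (h : IsRegularSolution α ℓ lam Φ p)
    (hα : α ∈ Ico (1 : ℝ) 2) (hℓ : 0 < ℓ) (h0 : Φ ℓ = 0) (hne : ∃ x ∈ Ioc 0 ℓ, Φ x ≠ 0) :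
    regularSol α lam ℓ = 0 ∧ ∃ c : ℝ, ∀ x ∈ Ioc 0 ℓ, Φ x = c * regularSol α lam x := by
  have hα0 : 0 ≤ α := by linarith [hα.1]
  have hW := h.wronskian_eq_zero hα hℓ
  rw [h0, zero_mul, zero_sub, neg_eq_zero, mul_eq_zero] at hW
  have hu : regularSol α lam ℓ = 0 := by
    refine hW.resolve_left fun hp => ?_
    obtain ⟨x, hx, hx'⟩ := hne
    exact hx' (h.eq_zero_of_right hα0 h0 hp hx)
  -- This ratio makes both the value and the flux of the difference vanish at `ℓ`.
  refine ⟨hu, p ℓ / regularFlux α lam ℓ, fun x hx => ?_⟩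
  have h2 := (h.sub_const_mul (isRegularSolution_regularSol hα ℓ lam)
    (p ℓ / regularFlux α lam ℓ)).eq_zero_of_right hα0 (by simp [h0, hu])
    (by rw [div_mul_cancel₀ _ (regularFlux_ne_zero hα hℓ hu), sub_self]) hx
  exact sub_eq_zero.1 h2

end RegularSolution

/-! ### Weak eigenfunctions are the classical regular solutions. -/

section Eigenfunctions

open MeasureTheory intervalIntegral

variable {α ℓ lam c : ℝ} {Φ p : ℝ → ℝ}

theorem Continuous.memLp_intervalMeasure {f : ℝ → ℝ} (hf : Continuous f) (ℓ : ℝ) :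
    MemLp f 2 (intervalMeasure ℓ) := by
  obtain ⟨C, hC⟩ := isCompact_Icc.exists_bound_of_continuousOn (s := Icc 0 ℓ) hf.continuousOn
  refine MemLp.of_bound hf.aestronglyMeasurable C ?_
  filter_upwards [ae_restrict_mem measurableSet_Ioo] with x hx using hC x (Ioo_subset_Icc_self hx)

/-- An absolutely continuous function whose derivative agrees almost everywhere with a continuous
function is differentiable. -/
theorem AbsolutelyContinuousOnInterval.hasDerivAt_of_ae_eq {f g : ℝ → ℝ} {a b x : ℝ}
    (hf : AbsolutelyContinuousOnInterval f a b) (hg : ContinuousOn g (Icc a b))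
    (h : ∀ᵐ y ∂volume.restrict (Ioo a b), deriv f y = g y) (hx : x ∈ Ioo a b) :
    HasDerivAt f (g x) x := by
  have hab : a ≤ b := (hx.1.trans hx.2).le
  have hint : IntervalIntegrable g volume a b := by
    rw [← uIcc_of_le hab] at hg; exact hg.intervalIntegrable
  have key : ∀ y ∈ Ioo a b, f y = f a + ∫ t in a..y, g t := by
    intro y hy
    have h1 : AbsolutelyContinuousOnInterval f a y :=
      hf.mono (by rw [uIcc_of_le hab, uIcc_of_le hy.1.le]; exact Icc_subset_Icc_right hy.2.le)
    have h2 : ∫ t in a..y, deriv f t = ∫ t in a..y, g t := by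
      rw [integral_of_le hy.1.le, integral_of_le hy.1.le]
      exact MeasureTheory.integral_congr_ae (ae_restrict_of_ae_restrict_of_subset
        (show Ioc a y ⊆ Ioo a b from fun t ht => ⟨ht.1, ht.2.trans_lt hy.2⟩) h)
    rw [← h2, h1.integral_deriv_eq_sub]; ring
  have hd : HasDerivAt (fun y => f a + ∫ t in a..y, g t) (g x) x := by
    refine (integral_hasDerivAt_right (hint.mono_set ?_) ?_ ?_).const_add _
    · rw [uIcc_of_le hab, uIcc_of_le hx.1.le]; exact Icc_subset_Icc_right hx.2.le
    · exact (hg.mono Ioo_subset_Icc_self).stronglyMeasurableAtFilter isOpen_Ioo x hx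
    · exact hg.continuousAt (Icc_mem_nhds hx.1 hx.2)
  refine hd.congr_of_eventuallyEq ?_
  filter_upwards [Ioo_mem_nhds hx.1 hx.2] with y hy using key y hy

/-- Bootstrap with the continuous representative `w` of the flux. Almost everywhere `Φ' = x^(-α) w`,
which is continuous away from `0`, so the equality holds everywhere in `(0, ℓ)`; then `w' = -lam Φ`
follows in the same way. Working on `[x/2, ℓ]` keeps clear of the singularity. -/
theorem IsEigenfunction.exists_isRegularSolution (h : IsEigenfunction α ℓ lam Φ) (hℓ : 0 < ℓ) :
    ∃ p, IsRegularSolution α ℓ lam Φ p := by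
  obtain ⟨w, hw, hweq, -⟩ := h.memDomain.flux
  have hwc : ContinuousOn w (Icc 0 ℓ) := by simpa [uIcc_of_le hℓ.le] using hw.continuousOn
  have hac := h.memDomain.memH1Weighted.locallyAC
  have hΦc : ContinuousOn Φ (Ioc 0 ℓ) := by
    intro x hx
    have h1 := (hac (x / 2) ⟨by linarith [hx.1], by linarith [hx.1, hx.2]⟩).continuousOn
    rw [uIcc_of_le (by linarith [hx.1, hx.2])] at h1
    refine (h1 x ⟨by linarith [hx.1], hx.2⟩).mono_of_mem_nhdsWithin ?_
    filter_upwards [self_mem_nhdsWithin, mem_nhdsWithin_of_mem_nhds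
      (lt_mem_nhds (show x / 2 < x by linarith [hx.1]))] with y hy hy' using ⟨hy'.le, hy.2⟩
  have hΦd : ∀ x ∈ Ioo 0 ℓ, HasDerivAt Φ (x ^ (-α) * w x) x := by
    intro x hx
    have hsub : Icc (x / 2) ℓ ⊆ Ioc 0 ℓ := fun y hy => ⟨by linarith [hx.1, hy.1], hy.2⟩
    have hsub' : Ioo (x / 2) ℓ ⊆ Ioo 0 ℓ := fun y hy => ⟨by linarith [hx.1, hy.1], hy.2⟩
    refine (hac (x / 2) ⟨by linarith [hx.1], by linarith [hx.1, hx.2]⟩).hasDerivAt_of_ae_eq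
      (g := fun y => y ^ (-α) * w y) ?_ ?_ ⟨by linarith [hx.1], hx.2⟩
    · refine ContinuousOn.mul (fun y hy => ?_) (hwc.mono (hsub.trans Ioc_subset_Icc_self))
      exact (Real.continuousAt_rpow_const _ _ (Or.inl (hsub hy).1.ne')).continuousWithinAt
    · filter_upwards [ae_restrict_of_ae_restrict_of_subset hsub' hweq,
        ae_restrict_mem measurableSet_Ioo] with y hy hy'
      have hy0 : 0 < y := (hsub' hy').1
      rw [← hy, ← mul_assoc, ← Real.rpow_add hy0, neg_add_cancel, Real.rpow_zero, one_mul]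
  have hflux : ∀ x ∈ Ioo 0 ℓ, x ^ α * deriv Φ x = w x := by
    intro x hx
    rw [(hΦd x hx).deriv, ← mul_assoc, ← Real.rpow_add hx.1, add_neg_cancel, Real.rpow_zero,
      one_mul]
  have hw0 : w 0 = 0 := by
    have h1 : Tendsto w (𝓝[>] 0) (𝓝 (w 0)) := by
      refine (hwc 0 ⟨le_rfl, hℓ.le⟩).tendsto.mono_left (nhdsWithin_le_of_mem ?_)
      exact mem_of_superset (Ioc_mem_nhdsGT hℓ) Ioc_subset_Icc_self
    refine tendsto_nhds_unique h1 (h.neumann.congr' ?_)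
    filter_upwards [Ioo_mem_nhdsGT hℓ] with x hx using hflux x hx
  refine ⟨w, hΦc, hwc, hw0, hΦd, fun x hx => ?_⟩
  have hsub : Icc (x / 2) ℓ ⊆ Ioc 0 ℓ := fun y hy => ⟨by linarith [hx.1, hy.1], hy.2⟩
  have hsub' : Ioo (x / 2) ℓ ⊆ Ioo 0 ℓ := fun y hy => ⟨by linarith [hx.1, hy.1], hy.2⟩
  have hw' : AbsolutelyContinuousOnInterval w (x / 2) ℓ := hw.mono (by
    rw [uIcc_of_le hℓ.le, uIcc_of_le (by linarith [hx.1, hx.2])]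
    exact hsub.trans Ioc_subset_Icc_self)
  refine hw'.hasDerivAt_of_ae_eq (g := fun y => -(lam * Φ y))
    ((hΦc.mono hsub).const_mul lam).neg ?_ ⟨by linarith [hx.1], hx.2⟩
  filter_upwards [ae_restrict_of_ae_restrict_of_subset hsub' h.equation,
    ae_restrict_mem measurableSet_Ioo] with y hy hy'
  have hev : (fun y => y ^ α * deriv Φ y) =ᶠ[𝓝 y] w := by
    filter_upwards [Ioo_mem_nhds (hsub' hy').1 (hsub' hy').2] with z hz using hflux z hz
  rw [← hy, hev.deriv_eq, neg_neg]

theorem exists_mem_Ioc_ne_zero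
    (hne : ¬ Φ =ᵐ[intervalMeasure ℓ] 0) : ∃ x ∈ Ioc 0 ℓ, Φ x ≠ 0 := by
  by_contra! hcon
  refine hne ?_
  filter_upwards [ae_restrict_mem measurableSet_Ioo] with x hx using
    hcon x (Ioo_subset_Ioc_self hx)

theorem IsEigenfunction.eq_const_mul (h : IsEigenfunction α ℓ lam Φ) (hα : α ∈ Ico (1 : ℝ) 2)
    (hℓ : 0 < ℓ) : regularSol α lam ℓ = 0 ∧ ∃ c : ℝ, ∀ x ∈ Ioc 0 ℓ, Φ x = c * regularSol α lam x := by
  obtain ⟨p, hp⟩ := h.exists_isRegularSolution hℓ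
  exact hp.eq_const_mul hα hℓ h.dirichlet (exists_mem_Ioc_ne_zero h.ne_zero)

theorem regularFlux_eq_integral (hα : α ∈ Ico (1 : ℝ) 2) (lam : ℝ) {x : ℝ} (hx : 0 ≤ x) :
    regularFlux α lam x = ∫ t in (0 : ℝ)..x, -(lam * regularSol α lam t) := by
  rw [integral_eq_sub_of_hasDerivAt_of_le hx (continuous_regularFlux hα lam).continuousOn
    (fun y hy => hasDerivAt_regularFlux hα lam hy.1)
    (((continuous_regularSol hα lam).const_mul lam).neg.intervalIntegrable _ _)]
  simp [regularFlux]

/-- Equality is asked only on `(0, ℓ]`: for `α > 1` the convention `0 ^ ((1 - α) / 2) = 0` makes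
`besselEigenfunction` vanish at `0`, unlike the continuous extension. -/
theorem isEigenfunction_of_eqOn (hα : α ∈ Ico (1 : ℝ) 2) (hℓ : 0 < ℓ)
    (h0 : regularSol α lam ℓ = 0) (hc : c ≠ 0)
    (hΦ : ∀ x ∈ Ioc 0 ℓ, Φ x = c * regularSol α lam x) : IsEigenfunction α ℓ lam Φ := by
  have hu := continuous_regularSol hα lam
  have hae : Φ =ᵐ[intervalMeasure ℓ] fun x => c * regularSol α lam x := by
    filter_upwards [ae_restrict_mem measurableSet_Ioo] with x hx using hΦ x (Ioo_subset_Ioc_self hx)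
  have hd : ∀ x ∈ Ioo 0 ℓ, HasDerivAt Φ (c * (x ^ (-α) * regularFlux α lam x)) x := by
    intro x hx
    refine ((hasDerivAt_regularSol hα lam hx.1).const_mul c).congr_of_eventuallyEq ?_
    filter_upwards [Ioo_mem_nhds hx.1 hx.2] with y hy using hΦ y (Ioo_subset_Ioc_self hy)
  have hflux : ∀ x ∈ Ioo 0 ℓ, x ^ α * deriv Φ x = c * regularFlux α lam x := by
    intro x hx
    rw [(hd x hx).deriv, mul_left_comm, ← mul_assoc (x ^ α), ← Real.rpow_add hx.1, add_neg_cancel,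
      Real.rpow_zero, one_mul]
  have hℓ0 : Φ ℓ = 0 := by rw [hΦ ℓ ⟨hℓ, le_rfl⟩, h0, mul_zero]
  refine ⟨⟨⟨?_, ?_, ?_⟩, hℓ0, ?_⟩, ?_, ?_, ?_, hℓ0⟩
  · exact ((hu.const_mul c).memLp_intervalMeasure ℓ).ae_eq hae.symm
  · intro ε hε
    have hpos : ∀ x ∈ Icc ε ℓ, 0 < x := fun x hx => hε.1.trans_le hx.1
    have hcont : ContinuousOn (fun x => c * (x ^ (-α) * regularFlux α lam x)) (Icc ε ℓ) := by
      refine continuousOn_const.mul (ContinuousOn.mul (fun y hy => ?_)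
        (continuous_regularFlux hα lam).continuousOn)
      exact (Real.continuousAt_rpow_const _ _ (Or.inl (hpos y hy).ne')).continuousWithinAt
    obtain ⟨C, hC⟩ := isCompact_Icc.exists_bound_of_continuousOn hcont
    refine LipschitzOnWith.absolutelyContinuousOnInterval (K := C.toNNReal) ?_
    rw [uIcc_of_le hε.2.le]
    refine Convex.lipschitzOnWith_of_nnnorm_hasDerivWithin_le (convex_Icc _ _)
      (f' := fun x => c * (x ^ (-α) * regularFlux α lam x)) (fun x hx => ?_) (fun x hx => ?_)
    · refine ((hasDerivAt_regularSol hα lam (hpos x hx)).const_mul c).hasDerivWithinAt.congr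
        (fun y hy => hΦ y ⟨hpos y hy, hy.2⟩) (hΦ x ⟨hpos x hx, hx.2⟩)
    · rw [← NNReal.coe_le_coe, coe_nnnorm]
      exact (hC x hx).trans (Real.le_coe_toNNReal C)
  -- The factor `x` in the flux leaves the positive power `x^(α/2 - α + 1)`, so the weighted
  -- derivative is bounded.
  · have hcont : Continuous fun x : ℝ => c * (x ^ (1 - α / 2) * (-(lam / (2 - α)) *
        besselEntire (nuOf α + 1) (lam * x ^ (2 - α) / (2 - α) ^ 2))) :=
      continuous_const.mul ((Real.continuous_rpow_const (by linarith [hα.2])).mul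
        (continuous_const.mul ((continuous_besselEntire (by linarith [nuOf_nonneg hα])).comp
          (continuous_regularArg hα lam))))
    refine (hcont.memLp_intervalMeasure ℓ).ae_eq ?_
    filter_upwards [ae_restrict_mem measurableSet_Ioo] with x hx
    have h1 : x ^ (1 - α / 2) = x ^ (α / 2) * x ^ (-α) * x := by
      rw [← Real.rpow_add hx.1]
      nth_rw 3 [← Real.rpow_one x]
      rw [← Real.rpow_add hx.1]; ring_nf
    rw [(hd x hx).deriv, regularFlux, h1]
    ring
  · have hI : ∀ x, HasDerivAt (fun x => c * ∫ t in (0 : ℝ)..x, -(lam * regularSol α lam t))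
        (c * -(lam * regularSol α lam x)) x := fun x =>
      ((hu.const_mul lam).neg.integral_hasStrictDerivAt 0 x).hasDerivAt.const_mul c
    refine ⟨fun x => c * ∫ t in (0 : ℝ)..x, -(lam * regularSol α lam t), ?_, ?_, ?_⟩
    · exact (((hu.const_mul lam).neg.intervalIntegrable 0
        ℓ).absolutelyContinuousOnInterval_intervalIntegral left_mem_uIcc).const_mul c
    · filter_upwards [ae_restrict_mem measurableSet_Ioo] with x hx
      rw [hflux x hx, regularFlux_eq_integral hα lam hx.1.le]
    · rw [funext fun x => (hI x).deriv]
      exact (continuous_const.mul (hu.const_mul lam).neg).memLp_intervalMeasure ℓ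
  · intro hz
    obtain ⟨x, hx, hne⟩ := exists_regularSol_ne_zero hα hℓ lam
    have := Measure.eqOn_open_of_ae_eq (hae.symm.trans hz) isOpen_Ioo
      (hu.const_mul c).continuousOn continuousOn_const hx
    simp [hc, hne] at this
  · filter_upwards [ae_restrict_mem measurableSet_Ioo] with x hx
    have hev : (fun y => y ^ α * deriv Φ y) =ᶠ[𝓝 x] fun y => c * regularFlux α lam y := by
      filter_upwards [Ioo_mem_nhds hx.1 hx.2] with z hz using hflux z hz
    rw [hev.deriv_eq, ((hasDerivAt_regularFlux hα lam hx.1).const_mul c).deriv,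
      hΦ x (Ioo_subset_Ioc_self hx)]
    ring
  · have := ((continuous_regularFlux hα lam).const_mul c).tendsto 0
    simp only [regularFlux, zero_mul, mul_zero] at this
    refine (this.mono_left nhdsWithin_le_nhds).congr' ?_
    filter_upwards [Ioo_mem_nhdsGT hℓ] with x hx
    rw [hflux x hx, regularFlux]

end Eigenfunctions

/-! ### Orthogonality and norms of the regular solutions. -/

section Integrals

open intervalIntegral

variable {α ℓ lam mu : ℝ}

/-- Lagrange identity: `(p_λ u_μ - p_μ u_λ)' = (μ - λ) u_λ u_μ`, with zero boundary terms at both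
ends. -/
theorem integral_regularSol_mul_eq_zero (hα : α ∈ Ico (1 : ℝ) 2) (hℓ : 0 < ℓ)
    (h1 : regularSol α lam ℓ = 0) (h2 : regularSol α mu ℓ = 0) (hne : lam ≠ mu) :
    ∫ x in (0 : ℝ)..ℓ, regularSol α lam x * regularSol α mu x = 0 := by
  have hc1 := continuous_regularSol hα lam
  have hc2 := continuous_regularSol hα mu
  have hp1 := continuous_regularFlux hα lam
  have hp2 := continuous_regularFlux hα mu
  have h := integral_eq_sub_of_hasDerivAt_of_le hℓ.le
    (f := fun x => regularFlux α lam x * regularSol α mu x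
      - regularFlux α mu x * regularSol α lam x)
    (f' := fun x => (mu - lam) * (regularSol α lam x * regularSol α mu x))
    (by fun_prop)
    (fun x hx => (((hasDerivAt_regularFlux hα lam hx.1).fun_mul
      (hasDerivAt_regularSol hα mu hx.1)).fun_sub ((hasDerivAt_regularFlux hα mu hx.1).fun_mul
      (hasDerivAt_regularSol hα lam hx.1))).congr_deriv (by ring))
    (Continuous.intervalIntegrable (by fun_prop) _ _)
  rw [integral_const_mul] at h
  simp only [h1, h2, regularFlux, mul_zero, zero_mul, sub_zero] at h
  exact (mul_eq_zero.1 h).resolve_left (sub_ne_zero.2 hne.symm)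

/-- Rellich identity: `(x^(1-α) p² + λ x u² + (α-1) p u)' = (2-α) λ u²`. At `ℓ` only the first term
survives, and at `0` none does. -/
theorem integral_regularSol_sq (hα : α ∈ Ico (1 : ℝ) 2) (hℓ : 0 < ℓ)
    (h0 : regularSol α lam ℓ = 0) :
    (2 - α) * lam * ∫ x in (0 : ℝ)..ℓ, regularSol α lam x ^ 2
      = ℓ ^ (1 - α) * regularFlux α lam ℓ ^ 2 := by
  have hu := continuous_regularSol hα lam
  have hp := continuous_regularFlux hα lam
  set k : ℝ → ℝ := fun x => -(lam / (2 - α)) *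
    besselEntire (nuOf α + 1) (lam * x ^ (2 - α) / (2 - α) ^ 2) with hk
  have hkc : Continuous k := continuous_const.mul ((continuous_besselEntire (ν := nuOf α + 1)
    (by linarith [nuOf_nonneg hα])).comp (continuous_regularArg hα lam))
  have hpow : Continuous fun x : ℝ => x ^ (3 - α) := Real.continuous_rpow_const (by linarith [hα.2])
  -- With `p = x k`, the term `x^(1-α) p²` becomes `x^(3-α) k²`, which is continuous up to `0`.
  have hpk : ∀ x : ℝ, 0 < x →
      x ^ (3 - α) * k x ^ 2 = x ^ (1 - α) * regularFlux α lam x ^ 2 := by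
    intro x hx
    rw [show 3 - α = 1 - α + (2 : ℕ) by push_cast; ring, Real.rpow_add_natCast hx.ne',
      show regularFlux α lam x = x * k x from rfl]
    ring
  have h := integral_eq_sub_of_hasDerivAt_of_le hℓ.le
    (f := fun x => x ^ (3 - α) * k x ^ 2 + lam * (x * regularSol α lam x ^ 2)
      + (α - 1) * (regularFlux α lam x * regularSol α lam x))
    (f' := fun x => (2 - α) * lam * regularSol α lam x ^ 2)
    (by fun_prop)
    (fun x hx => by
      have d1 : HasDerivAt (fun x : ℝ => x ^ (1 - α)) ((1 - α) * x ^ (-α)) x :=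
        (Real.hasDerivAt_rpow_const (p := 1 - α) (Or.inl hx.1.ne')).congr_deriv (by
          rw [show 1 - α - 1 = -α by ring])
      have du := hasDerivAt_regularSol hα lam hx.1
      have dp := hasDerivAt_regularFlux hα lam hx.1
      have hx1 : x ^ (1 - α) = x ^ (-α) * x := by
        rw [show 1 - α = -α + 1 by ring, Real.rpow_add hx.1, Real.rpow_one]
      have d2 := ((d1.fun_mul (dp.fun_pow 2)).fun_add
        (((hasDerivAt_id x).fun_mul (du.fun_pow 2)).const_mul lam)).fun_add
        ((dp.fun_mul du).const_mul (α - 1))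
      have hev : (fun x => x ^ (3 - α) * k x ^ 2 + lam * (x * regularSol α lam x ^ 2)
          + (α - 1) * (regularFlux α lam x * regularSol α lam x)) =ᶠ[𝓝 x]
          fun x => x ^ (1 - α) * regularFlux α lam x ^ 2 + lam * (id x * regularSol α lam x ^ 2)
          + (α - 1) * (regularFlux α lam x * regularSol α lam x) := by
        filter_upwards [lt_mem_nhds hx.1] with y hy
        rw [hpk y hy, id]
      refine (d2.congr_of_eventuallyEq hev).congr_deriv ?_
      rw [hx1]
      simp
      ring)
    (Continuous.intervalIntegrable (by fun_prop) _ _)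
  rw [integral_const_mul] at h
  rw [h, hpk ℓ hℓ, h0, Real.zero_rpow (by linarith [hα.2])]
  simp [regularFlux]

end Integrals

/-! ### Hilbert–Schmidt operators are compact. -/

noncomputable section
open MeasureTheory

section HilbertSchmidt

variable {X H : Type*} [MeasurableSpace X] {μ : Measure X} [NormedAddCommGroup H]
  [InnerProductSpace ℝ H]

/-- The Hilbert–Schmidt operator `f ↦ (x ↦ ⟪f, k x⟫)` with kernel `k ∈ L²(μ; H)`. -/
def hilbertSchmidtOperator (k : Lp H 2 μ) : H →L[ℝ] Lp ℝ 2 μ :=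
  (ContinuousLinearMap.compLpL₂ 2 μ (innerSL ℝ : H →L[ℝ] H →L[ℝ] ℝ)).flip k

theorem hilbertSchmidtOperator_apply_ae (k : Lp H 2 μ) (f : H) :
    hilbertSchmidtOperator k f =ᵐ[μ] fun x => inner ℝ f (k x) :=
  ContinuousLinearMap.coeFn_compLp (innerSL ℝ f) k

/-- An indicator kernel gives an operator of rank at most one. Compactness passes to sums and to
norm limits, and the operator depends continuously on its kernel. -/
theorem isCompactOperator_hilbertSchmidtOperator (k : Lp H 2 μ) :
    IsCompactOperator (hilbertSchmidtOperator k) := by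
  induction k using Lp.induction with
  | hp_ne_top => simp
  | @indicatorConst c s hs hμs =>
    have h : hilbertSchmidtOperator (Lp.simpleFunc.indicatorConst 2 hs hμs.ne c : Lp H 2 μ)
        = (ContinuousLinearMap.toSpanSingleton ℝ (indicatorConstLp 2 hs hμs.ne (1 : ℝ))).comp
          (innerSL ℝ c) := by
      ext1 f
      apply Lp.ext
      have h1 := hilbertSchmidtOperator_apply_ae
        (Lp.simpleFunc.indicatorConst 2 hs hμs.ne c : Lp H 2 μ) f
      rw [Lp.simpleFunc.coe_indicatorConst] at h1 ⊢
      refine h1.trans ?_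
      simp only [ContinuousLinearMap.comp_apply, ContinuousLinearMap.toSpanSingleton_apply]
      filter_upwards [indicatorConstLp_coeFn (p := 2) (hs := hs) (hμs := hμs.ne) (c := c),
        indicatorConstLp_coeFn (p := 2) (hs := hs) (hμs := hμs.ne) (c := (1 : ℝ)),
        Lp.coeFn_smul (innerSL ℝ c f) (indicatorConstLp 2 hs hμs.ne (1 : ℝ))] with x h2 h3 h4
      rw [h4, Pi.smul_apply, h2, h3]
      by_cases hx : x ∈ s <;> simp [hx, real_inner_comm]
    rw [h]
    exact (isCompactOperator_of_locallyCompactSpace_rng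
      (ContinuousLinearMap.toSpanSingleton ℝ (indicatorConstLp 2 hs hμs.ne (1 : ℝ)))).comp_clm _
  | add hf hg _ h1 h2 =>
    have : hilbertSchmidtOperator (hf.toLp _ + hg.toLp _)
        = hilbertSchmidtOperator (hf.toLp _) + hilbertSchmidtOperator (hg.toLp _) :=
      map_add _ _ _
    rw [this]
    exact h1.add h2
  | isClosed =>
    exact (isClosed_setOfPred_isCompactOperator (σ₁₂ := RingHom.id ℝ)).preimage
      (ContinuousLinearMap.compLpL₂ 2 μ (innerSL ℝ : H →L[ℝ] H →L[ℝ] ℝ)).flip.continuous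

end HilbertSchmidt

/-! ### The Green operator `T*T`. -/

section Primitive

variable {α ℓ : ℝ}

/-- The indicator of `(0, t]` as an element of `L²(0, ℓ)`. -/
def stepLp (ℓ t : ℝ) : Lp ℝ 2 (intervalMeasure ℓ) :=
  indicatorConstLp 2 (measurableSet_Ioc (a := (0 : ℝ)) (b := t))
    (measure_ne_top (intervalMeasure ℓ) _) 1

/-- The clamping at `0` and `ℓ` makes the formula valid for all real `s`, `t`, which gives
continuity of `stepLp ℓ` on the whole line. -/
theorem inner_stepLp_stepLp (hℓ : 0 < ℓ) (s t : ℝ) :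
    inner ℝ (stepLp ℓ s) (stepLp ℓ t) = max 0 (min ℓ (min s t)) := by
  rw [stepLp, stepLp, L2.real_inner_indicatorConstLp_one_indicatorConstLp_one, Ioc_inter_Ioc,
    sup_idem, intervalMeasure, measureReal_restrict_apply measurableSet_Ioc]
  rcases le_or_gt ℓ (min s t) with h | h
  · have : Ioc 0 (s ⊓ t) ∩ Ioo 0 ℓ = Ioo 0 ℓ :=
      inter_eq_right.2 fun x hx => ⟨hx.1, hx.2.le.trans h⟩
    rw [this, min_eq_left h]; simp [hℓ.le]
  · have : Ioc 0 (s ⊓ t) ∩ Ioo 0 ℓ = Ioc 0 (s ⊓ t) :=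
      inter_eq_left.2 fun x hx => ⟨hx.1, hx.2.trans_lt h⟩
    rw [this, min_eq_right h.le, measureReal_def, Real.volume_Ioc, ENNReal.toReal_ofReal', sub_zero,
      max_comm]

theorem continuous_stepLp (hℓ : 0 < ℓ) : Continuous (stepLp ℓ) := by
  rw [continuous_iff_continuousAt]
  intro t
  rw [ContinuousAt, tendsto_iff_norm_sub_tendsto_zero]
  have h : ∀ s, ‖stepLp ℓ s - stepLp ℓ t‖
      = √(max 0 (min ℓ s) - 2 * max 0 (min ℓ (min s t)) + max 0 (min ℓ t)) := fun s => by
    rw [← Real.sqrt_sq (norm_nonneg (stepLp ℓ s - stepLp ℓ t)), norm_sub_sq_real,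
      ← real_inner_self_eq_norm_sq, ← real_inner_self_eq_norm_sq, inner_stepLp_stepLp hℓ,
      inner_stepLp_stepLp hℓ, inner_stepLp_stepLp hℓ, min_self, min_self]
  simp only [h]
  have hc : Continuous fun s : ℝ =>
      √(max 0 (min ℓ s) - 2 * max 0 (min ℓ (min s t)) + max 0 (min ℓ t)) := by fun_prop
  have := hc.tendsto t
  simp only [min_self] at this
  convert this
  rw [eq_comm, Real.sqrt_eq_zero']
  linarith

-- The squared norm at `t` is `t^(-α) * t = t^(1-α)`, integrable at `0` because `α < 2`.
variable (α ℓ) in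
theorem memLp_weighted_stepLp (hα : α ∈ Ico (1 : ℝ) 2) (hℓ : 0 < ℓ) :
    MemLp (fun t : ℝ => t ^ (-(α / 2)) • stepLp ℓ t) 2 (intervalMeasure ℓ) := by
  have hm : AEStronglyMeasurable (fun t : ℝ => t ^ (-(α / 2)) • stepLp ℓ t) (intervalMeasure ℓ) :=
    (measurable_id.pow_const _).aestronglyMeasurable.smul
      (continuous_stepLp hℓ).aestronglyMeasurable
  rw [memLp_two_iff_integrable_sq_norm hm]
  have hi : IntegrableOn (fun t : ℝ => t ^ (1 - α)) (Ioo 0 ℓ) :=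
    (intervalIntegrable_iff_integrableOn_Ioo_of_le hℓ.le).1
      (intervalIntegral.intervalIntegrable_rpow' (by linarith [hα.2]))
  refine hi.congr ?_
  filter_upwards [ae_restrict_mem measurableSet_Ioo] with t ht
  rw [norm_smul, mul_pow, ← real_inner_self_eq_norm_sq (stepLp ℓ t), inner_stepLp_stepLp hℓ, min_self,
    min_eq_right ht.2.le, max_eq_right ht.1.le, Real.norm_eq_abs, sq_abs, ← Real.rpow_natCast,
    ← Real.rpow_mul ht.1.le, ← Real.rpow_add_one ht.1.ne']
  congr 1; push_cast; ring

/-- The kernel of `f ↦ (t ↦ t^(-α/2) ∫₀ᵗ f)`. -/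
def weightedKernel (hα : α ∈ Ico (1 : ℝ) 2) (hℓ : 0 < ℓ) :
    Lp (Lp ℝ 2 (intervalMeasure ℓ)) 2 (intervalMeasure ℓ) :=
  (memLp_weighted_stepLp α ℓ hα hℓ).toLp _

/-- The operator `f ↦ (t ↦ t^(-α/2) ∫₀ᵗ f)` on `L²(0, ℓ)`. -/
def weightedPrimitive (hα : α ∈ Ico (1 : ℝ) 2) (hℓ : 0 < ℓ) :
    Lp ℝ 2 (intervalMeasure ℓ) →L[ℝ] Lp ℝ 2 (intervalMeasure ℓ) :=
  hilbertSchmidtOperator (weightedKernel hα hℓ)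

/-- The inverse of `u ↦ -(x^α u')'`. -/
def greenOperator (hα : α ∈ Ico (1 : ℝ) 2) (hℓ : 0 < ℓ) :
    Lp ℝ 2 (intervalMeasure ℓ) →L[ℝ] Lp ℝ 2 (intervalMeasure ℓ) :=
  (ContinuousLinearMap.adjoint (weightedPrimitive hα hℓ)).comp (weightedPrimitive hα hℓ)

theorem weightedPrimitive_ae (hα : α ∈ Ico (1 : ℝ) 2) (hℓ : 0 < ℓ)
    (f : Lp ℝ 2 (intervalMeasure ℓ)) :
    weightedPrimitive hα hℓ f =ᵐ[intervalMeasure ℓ]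
      fun t => t ^ (-(α / 2)) * inner ℝ f (stepLp ℓ t) := by
  filter_upwards [hilbertSchmidtOperator_apply_ae (weightedKernel hα hℓ) f,
    (memLp_weighted_stepLp α ℓ hα hℓ).coeFn_toLp] with t h1 h2
  rw [weightedPrimitive, h1, weightedKernel, h2, real_inner_smul_right]

theorem isCompactOperator_greenOperator (hα : α ∈ Ico (1 : ℝ) 2) (hℓ : 0 < ℓ) :
    IsCompactOperator (greenOperator hα hℓ) :=
  (isCompactOperator_hilbertSchmidtOperator (weightedKernel hα hℓ)).clm_comp
    (ContinuousLinearMap.adjoint (weightedPrimitive hα hℓ))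

theorem inner_greenOperator (hα : α ∈ Ico (1 : ℝ) 2) (hℓ : 0 < ℓ)
    (f g : Lp ℝ 2 (intervalMeasure ℓ)) :
    inner ℝ (greenOperator hα hℓ f) g
      = inner ℝ (weightedPrimitive hα hℓ f) (weightedPrimitive hα hℓ g) := by
  rw [greenOperator, ContinuousLinearMap.comp_apply, ContinuousLinearMap.adjoint_inner_left]

theorem isSymmetric_greenOperator (hα : α ∈ Ico (1 : ℝ) 2) (hℓ : 0 < ℓ) :
    (greenOperator hα hℓ).IsSymmetric := fun f g => by
  change inner ℝ (greenOperator hα hℓ f) g = inner ℝ f (greenOperator hα hℓ g)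
  rw [inner_greenOperator, ← real_inner_comm, ← inner_greenOperator, real_inner_comm]

/-- Pairing `G f` with the indicator of `(0, x]` yields the primitive of `G f`, so an explicit
adjoint of `T` is never needed. -/
theorem inner_stepLp_ae (hα : α ∈ Ico (1 : ℝ) 2) (hℓ : 0 < ℓ) {x : ℝ} (hx : x ∈ Icc 0 ℓ)
    (f : Lp ℝ 2 (intervalMeasure ℓ)) :
    (fun t => inner ℝ (weightedPrimitive hα hℓ f t) (weightedPrimitive hα hℓ (stepLp ℓ x) t))
      =ᵐ[intervalMeasure ℓ] fun t => t ^ (-α) * inner ℝ f (stepLp ℓ t) * min x t := by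
  filter_upwards [weightedPrimitive_ae hα hℓ f, weightedPrimitive_ae hα hℓ (stepLp ℓ x),
    ae_restrict_mem measurableSet_Ioo] with t h1 h2 ht
  have h3 : max 0 (min ℓ (min x t)) = min x t := by
    rw [min_eq_right ((min_le_left _ _).trans hx.2), max_eq_right (le_min hx.1 ht.1.le)]
  have h4 : t ^ (-α) = t ^ (-(α / 2)) * t ^ (-(α / 2)) := by
    rw [← Real.rpow_add ht.1]; ring_nf
  rw [h1, h2, inner_stepLp_stepLp hℓ, h3, h4, Real.inner_apply]
  ring

end Primitive
end

/-! ### Eigenvectors of the Green operator and completeness. -/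

noncomputable section
open MeasureTheory

section GreenEigenvectors

variable {α ℓ m : ℝ}

/-- The primitive `t ↦ ∫₀ᵗ f`. -/
def primitiveLp (f : Lp ℝ 2 (intervalMeasure ℓ)) (t : ℝ) : ℝ := inner ℝ f (stepLp ℓ t)

/-- The antiderivative `x ↦ ∫ₓ^ℓ t^(-α) ∫₀ᵗ f` of the weighted flux. -/
def greenPotential (α : ℝ) (f : Lp ℝ 2 (intervalMeasure ℓ)) (x : ℝ) : ℝ :=
  ∫ t in x..ℓ, t ^ (-α) * primitiveLp f t

theorem continuous_primitiveLp (hℓ : 0 < ℓ) (f : Lp ℝ 2 (intervalMeasure ℓ)) :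
    Continuous (primitiveLp f) :=
  continuous_const.inner (continuous_stepLp hℓ)

theorem intervalIntegrable_Lp (hℓ : 0 < ℓ) (f : Lp ℝ 2 (intervalMeasure ℓ)) :
    IntervalIntegrable f volume 0 ℓ :=
  (intervalIntegrable_iff_integrableOn_Ioo_of_le hℓ.le).2 ((Lp.memLp f).integrable one_le_two)

theorem primitiveLp_eq (f : Lp ℝ 2 (intervalMeasure ℓ)) {x : ℝ} (hx : x ∈ Ico 0 ℓ) :
    primitiveLp f x = ∫ t in (0 : ℝ)..x, f t := by
  have h : (intervalMeasure ℓ).restrict (Ioc 0 x) = volume.restrict (Ioc 0 x) := by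
    have hs : Ioc 0 x ⊆ Ioo 0 ℓ := fun t ht => ⟨ht.1, ht.2.trans_lt hx.2⟩
    rw [intervalMeasure, Measure.restrict_restrict measurableSet_Ioc, inter_eq_left.2 hs]
  rw [primitiveLp, real_inner_comm, stepLp, L2.inner_indicatorConstLp_one, h,
    intervalIntegral.integral_of_le hx.1]

theorem ae_hasDerivAt_primitiveLp (hℓ : 0 < ℓ) (f : Lp ℝ 2 (intervalMeasure ℓ)) :
    ∀ᵐ x ∂intervalMeasure ℓ, HasDerivAt (primitiveLp f) (f x) x := by
  filter_upwards [ae_restrict_of_ae (intervalIntegrable_Lp hℓ f).ae_hasDerivAt_integral,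
    ae_restrict_mem measurableSet_Ioo] with x hx hx'
  rw [uIcc_of_le hℓ.le] at hx
  refine (hx (Ioo_subset_Icc_self hx') 0 ⟨le_rfl, hℓ.le⟩).congr_of_eventuallyEq ?_
  filter_upwards [Ioo_mem_nhds hx'.1 hx'.2] with y hy using primitiveLp_eq f (Ioo_subset_Ico_self hy)

theorem continuousOn_weighted_primitiveLp (α : ℝ) (hℓ : 0 < ℓ) (f : Lp ℝ 2 (intervalMeasure ℓ)) :
    ContinuousOn (fun t => t ^ (-α) * primitiveLp f t) (Ioi 0) :=
  ContinuousOn.mul (fun _ ht => (Real.continuousAt_rpow_const _ _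
    (Or.inl (ne_of_gt ht))).continuousWithinAt) (continuous_primitiveLp hℓ f).continuousOn

theorem hasDerivAt_greenPotential (α : ℝ) (hℓ : 0 < ℓ) (f : Lp ℝ 2 (intervalMeasure ℓ)) {x : ℝ}
    (hx : 0 < x) :
    HasDerivAt (greenPotential α f) (-(x ^ (-α) * primitiveLp f x)) x := by
  have hc := continuousOn_weighted_primitiveLp α hℓ f
  refine intervalIntegral.integral_hasDerivAt_left ?_ ?_ ?_
  · exact (hc.mono fun t ht => (lt_min hx hℓ).trans_le ht.1).intervalIntegrable
  · exact hc.stronglyMeasurableAtFilter isOpen_Ioi x hx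
  · exact hc.continuousAt (Ioi_mem_nhds hx)

theorem intervalIntegrable_weighted_primitiveLp (hα : α ∈ Ico (1 : ℝ) 2) (hℓ : 0 < ℓ)
    (f : Lp ℝ 2 (intervalMeasure ℓ)) {x : ℝ} (hx : x ∈ Icc 0 ℓ) :
    IntervalIntegrable (fun t => t ^ (-α) * primitiveLp f t * min x t) volume 0 ℓ := by
  rw [intervalIntegrable_iff_integrableOn_Ioo_of_le hℓ.le]
  exact (L2.integrable_inner (𝕜 := ℝ) (weightedPrimitive hα hℓ f)
    (weightedPrimitive hα hℓ (stepLp ℓ x))).congr (inner_stepLp_ae hα hℓ hx f)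

/-- Splits the integral against `min x t` at `t = x`. -/
theorem inner_greenOperator_stepLp (hα : α ∈ Ico (1 : ℝ) 2) (hℓ : 0 < ℓ)
    (f : Lp ℝ 2 (intervalMeasure ℓ)) {x : ℝ} (hx : x ∈ Ioo 0 ℓ) :
    inner ℝ (greenOperator hα hℓ f) (stepLp ℓ x)
      = (∫ t in (0 : ℝ)..x, t ^ (-α) * primitiveLp f t * t) + x * greenPotential α f x := by
  have hi := intervalIntegrable_weighted_primitiveLp hα hℓ f (Ioo_subset_Icc_self hx)
  have h0 : (0 : ℝ) ≤ ℓ := hℓ.le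
  have hi1 : IntervalIntegrable (fun t => t ^ (-α) * primitiveLp f t * min x t) volume 0 x :=
    hi.mono_set (by rw [uIcc_of_le h0, uIcc_of_le hx.1.le]; exact Icc_subset_Icc_right hx.2.le)
  have hi2 : IntervalIntegrable (fun t => t ^ (-α) * primitiveLp f t * min x t) volume x ℓ :=
    hi.mono_set (by rw [uIcc_of_le h0, uIcc_of_le hx.2.le]; exact Icc_subset_Icc_left hx.1.le)
  rw [inner_greenOperator, L2.inner_def,
    MeasureTheory.integral_congr_ae (inner_stepLp_ae hα hℓ (Ioo_subset_Icc_self hx) f),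
    ← integral_Ioc_eq_integral_Ioo, ← intervalIntegral.integral_of_le h0]
  change ∫ t in (0 : ℝ)..ℓ, t ^ (-α) * primitiveLp f t * min x t = _
  rw [← intervalIntegral.integral_add_adjacent_intervals hi1 hi2, greenPotential,
    ← intervalIntegral.integral_const_mul]
  congr 1
  · refine intervalIntegral.integral_congr fun t ht => ?_
    rw [uIcc_of_le hx.1.le] at ht
    simp only [min_eq_right ht.2]
  · refine intervalIntegral.integral_congr fun t ht => ?_
    rw [uIcc_of_le hx.2.le] at ht
    simp only [min_eq_left ht.1]
    ring

/-- The two terms `± x * x^(-α) ∫₀ˣ f` cancel; this identifies `G f` with `greenPotential α f`. -/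
theorem hasDerivAt_inner_greenOperator_stepLp (hα : α ∈ Ico (1 : ℝ) 2) (hℓ : 0 < ℓ)
    (f : Lp ℝ 2 (intervalMeasure ℓ)) {x : ℝ} (hx : x ∈ Ioo 0 ℓ) :
    HasDerivAt (fun x => inner ℝ (greenOperator hα hℓ f) (stepLp ℓ x)) (greenPotential α f x) x := by
  have hc : ContinuousOn (fun t => t ^ (-α) * primitiveLp f t * t) (Ioi 0) :=
    (continuousOn_weighted_primitiveLp α hℓ f).mul continuousOn_id
  have hi : IntervalIntegrable (fun t => t ^ (-α) * primitiveLp f t * t) volume 0 ℓ := by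
    refine (intervalIntegrable_weighted_primitiveLp hα hℓ f (x := ℓ) ⟨hℓ.le, le_rfl⟩).congr ?_
    intro t ht
    rw [uIoc_of_le hℓ.le] at ht
    simp only [min_eq_right ht.2]
  have h1 : HasDerivAt (fun x => ∫ t in (0 : ℝ)..x, t ^ (-α) * primitiveLp f t * t)
      (x ^ (-α) * primitiveLp f x * x) x := by
    refine intervalIntegral.integral_hasDerivAt_right (hi.mono_set ?_) ?_ ?_
    · rw [uIcc_of_le hℓ.le, uIcc_of_le hx.1.le]; exact Icc_subset_Icc_right hx.2.le
    · exact hc.stronglyMeasurableAtFilter isOpen_Ioi x hx.1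
    · exact hc.continuousAt (Ioi_mem_nhds hx.1)
  have h2 := h1.fun_add ((hasDerivAt_id x).fun_mul (hasDerivAt_greenPotential α hℓ f hx.1))
  refine (h2.congr_of_eventuallyEq ?_).congr_deriv ?_
  · filter_upwards [Ioo_mem_nhds hx.1 hx.2] with y hy
    rw [inner_greenOperator_stepLp hα hℓ f hy, id]
  · simp only [id]; ring

/-- `⟪G f, f⟫ = ‖T f‖²`, so the primitive of `f` vanishes, and with it `f`. Hence `0` is not an
eigenvalue of `G`. -/
theorem greenOperator_injective (hα : α ∈ Ico (1 : ℝ) 2) (hℓ : 0 < ℓ)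
    {f : Lp ℝ 2 (intervalMeasure ℓ)} (h : greenOperator hα hℓ f = 0) : f = 0 := by
  have h1 : weightedPrimitive hα hℓ f = 0 := by
    have := inner_greenOperator hα hℓ f f
    rwa [h, inner_zero_left, eq_comm, inner_self_eq_zero] at this
  have h2 : primitiveLp f =ᵐ[intervalMeasure ℓ] 0 := by
    have h3 := weightedPrimitive_ae hα hℓ f
    rw [h1] at h3
    filter_upwards [h3, Lp.coeFn_zero ℝ 2 (intervalMeasure ℓ),
      ae_restrict_mem measurableSet_Ioo] with t ht ht' ht0
    rw [ht'] at ht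
    exact (mul_eq_zero.1 ht.symm).resolve_left (Real.rpow_pos_of_pos ht0.1 _).ne'
  have h3 := Measure.eqOn_open_of_ae_eq h2 isOpen_Ioo
    (continuous_primitiveLp hℓ f).continuousOn continuousOn_const
  refine Lp.ext ?_
  filter_upwards [ae_hasDerivAt_primitiveLp hℓ f, Lp.coeFn_zero ℝ 2 (intervalMeasure ℓ),
      ae_restrict_mem measurableSet_Ioo] with x hx hx' hx0
  rw [hx']
  refine hx.unique ((hasDerivAt_const x (0 : ℝ)).congr_of_eventuallyEq ?_)
  filter_upwards [Ioo_mem_nhds hx0.1 hx0.2] with y hy using h3 hy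

/-- An eigenvector of the Green operator is a multiple of a regular solution vanishing at `ℓ`. -/
theorem exists_regularSol_of_greenOperator (hα : α ∈ Ico (1 : ℝ) 2) (hℓ : 0 < ℓ)
    {f : Lp ℝ 2 (intervalMeasure ℓ)} (h : greenOperator hα hℓ f = m • f) (hf : f ≠ 0) :
    ∃ lam c : ℝ, regularSol α lam ℓ = 0 ∧
      f =ᵐ[intervalMeasure ℓ] fun x => c * regularSol α lam x := by
  have hm : m ≠ 0 := by
    rintro rfl
    exact hf (greenOperator_injective hα hℓ (by rw [h, zero_smul]))
  have hd : ∀ x ∈ Ioo 0 ℓ, HasDerivAt (primitiveLp f) (m⁻¹ * greenPotential α f x) x := by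
    intro x hx
    refine ((hasDerivAt_inner_greenOperator_stepLp hα hℓ f hx).const_mul m⁻¹).congr_of_eventuallyEq
      (Eventually.of_forall fun y => ?_)
    simp only [h, real_inner_smul_left, inv_mul_cancel_left₀ hm, primitiveLp]
  have hae : f =ᵐ[intervalMeasure ℓ] fun x => m⁻¹ * greenPotential α f x := by
    filter_upwards [ae_hasDerivAt_primitiveLp hℓ f, ae_restrict_mem measurableSet_Ioo] with x hx hx'
      using hx.unique (hd x hx')
  -- From `f = m⁻¹ G f`, this representative of `f` has flux `-m⁻¹ ∫₀ˣ f` and solves the system with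
  -- `lam = m⁻¹`. It vanishes at `ℓ` as an integral over `[ℓ, ℓ]`.
  have hreg : IsRegularSolution α ℓ m⁻¹ (fun x => m⁻¹ * greenPotential α f x)
      (fun x => -(m⁻¹ * primitiveLp f x)) :=
    { continuousOn := fun x hx => ((hasDerivAt_greenPotential α hℓ f
        hx.1).const_mul m⁻¹).continuousAt.continuousWithinAt
      continuousOn_flux := ((continuous_primitiveLp hℓ f).const_mul _).neg.continuousOn
      flux_zero := by rw [primitiveLp_eq f ⟨le_rfl, hℓ⟩]; simp
      hasDerivAt := fun x hx =>
        ((hasDerivAt_greenPotential α hℓ f hx.1).const_mul m⁻¹).congr_deriv (by ring)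
      hasDerivAt_flux := fun x hx => ((hd x hx).const_mul m⁻¹).fun_neg }
  obtain ⟨h0, c, hc⟩ := hreg.eq_const_mul hα hℓ (by simp [greenPotential])
    (exists_mem_Ioc_ne_zero fun hz => hf (Lp.ext ((hae.trans hz).trans
      (Lp.coeFn_zero ℝ 2 (intervalMeasure ℓ)).symm)))
  refine ⟨m⁻¹, c, h0, hae.trans ?_⟩
  filter_upwards [ae_restrict_mem measurableSet_Ioo] with x hx using hc x (Ioo_subset_Ioc_self hx)

/-- `regularSol` as an element of `L²(0, ℓ)`. -/
def regularSolLp (hα : α ∈ Ico (1 : ℝ) 2) (ℓ lam : ℝ) : Lp ℝ 2 (intervalMeasure ℓ) :=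
  ((continuous_regularSol hα lam).memLp_intervalMeasure ℓ).toLp _

theorem regularSolLp_ae (hα : α ∈ Ico (1 : ℝ) 2) (ℓ lam : ℝ) :
    regularSolLp hα ℓ lam =ᵐ[intervalMeasure ℓ] regularSol α lam :=
  MemLp.coeFn_toLp _

/-- The regular solutions vanishing at `ℓ` are complete in `L²(0, ℓ)`. -/
theorem span_regularSolLp_orthogonal (hα : α ∈ Ico (1 : ℝ) 2) (hℓ : 0 < ℓ) :
    (Submodule.span ℝ (regularSolLp hα ℓ '' {lam | regularSol α lam ℓ = 0}))ᗮ = ⊥ := by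
  rw [eq_bot_iff, ← (greenOperator hα hℓ).orthogonalComplement_iSup_eigenspaces_eq_bot
    (isCompactOperator_greenOperator hα hℓ) (isSymmetric_greenOperator hα hℓ)]
  refine Submodule.orthogonal_le (iSup_le fun m f hf => ?_)
  rw [Module.End.mem_eigenspace_iff] at hf
  rcases eq_or_ne f 0 with rfl | hf0
  · exact zero_mem _
  obtain ⟨lam, c, h0, hc⟩ := exists_regularSol_of_greenOperator hα hℓ hf hf0
  have : f = c • regularSolLp hα ℓ lam := by
    refine Lp.ext (hc.trans ?_)
    filter_upwards [regularSolLp_ae hα ℓ lam, Lp.coeFn_smul c (regularSolLp hα ℓ lam)] with x h1 h2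
    rw [h2, Pi.smul_apply, h1, smul_eq_mul]
  rw [this]
  exact Submodule.smul_mem _ _ (Submodule.subset_span ⟨lam, h0, rfl⟩)

end GreenEigenvectors
end

open MeasureTheory

/-! ### Enumerating an infinite locally finite set. -/

section Enumeration

/-- A recursion that takes the next element of an infinite locally finite set of reals enumerates
that set increasingly. -/
theorem strictMono_and_eq_range_of_sInf {S : Set ℝ} {z : ℕ → ℝ} (h0 : ∀ y ∈ S, z 0 < y)
    (hinf : S.Infinite) (hfin : ∀ R, (S ∩ Iic R).Finite)
    (hz : ∀ n, z (n + 1) = sInf {y | z n < y ∧ y ∈ S}) :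
    StrictMono z ∧ S = {y | ∃ n : ℕ, 1 ≤ n ∧ y = z n} := by
  -- The infimum is attained: some element of `S` exceeds `z n`, and below it only finitely many
  -- compete.
  have hleast : ∀ n, IsLeast {y | z n < y ∧ y ∈ S} (z (n + 1)) := by
    intro n
    obtain ⟨y₀, hy₀, hy₀'⟩ := hinf.exists_notMem_finite (hfin (z n))
    have hy₁ : z n < y₀ := by
      by_contra! h
      exact hy₀' ⟨hy₀, h⟩
    obtain ⟨a, ha, ha'⟩ := Set.exists_min_image ({y | z n < y ∧ y ∈ S} ∩ Iic y₀) id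
      ((hfin y₀).subset fun y hy => ⟨hy.1.2, hy.2⟩) ⟨y₀, ⟨hy₁, hy₀⟩, mem_Iic.2 le_rfl⟩
    have hl : IsLeast {y | z n < y ∧ y ∈ S} a := by
      refine ⟨ha.1, fun y hy => ?_⟩
      rcases le_or_gt y y₀ with h | h
      · exact ha' y ⟨hy, h⟩
      · exact (mem_Iic.1 ha.2).trans h.le
    rw [hz, hl.csInf_eq]
    exact hl
  have hmono : StrictMono z := strictMono_nat_of_lt_succ fun n => (hleast n).1.1
  refine ⟨hmono, Subset.antisymm (fun y hy => ?_) ?_⟩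
  · have hex : ∃ n, y ≤ z n := by
      by_contra! h
      refine Set.infinite_range_of_injective (hmono.injective.comp (add_left_injective 1))
        ((hfin y).subset ?_)
      rintro _ ⟨n, rfl⟩
      exact ⟨(hleast n).1.2, (h (n + 1)).le⟩
    classical
    have hn := Nat.find_spec hex
    have hmin := fun k => Nat.find_min hex (m := k)
    rcases hk : Nat.find hex with _ | k
    · rw [hk] at hn
      exact absurd (h0 y hy) hn.not_gt
    · rw [hk] at hn hmin
      refine ⟨k + 1, by omega, hn.antisymm ((hleast k).2 ⟨?_, hy⟩)⟩
      exact not_le.1 (hmin k (by omega))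
  · rintro _ ⟨n, hn, rfl⟩
    obtain ⟨k, rfl⟩ : ∃ k, n = k + 1 := ⟨n - 1, by omega⟩
    exact (hleast k).1.2

end Enumeration

/-! ### The positive zeros of `J_ν`. -/

section Zeros

variable {α ℓ y : ℝ}

theorem kappaOf_pos (hα : α ∈ Ico (1 : ℝ) 2) : 0 < kappaOf α := by
  rw [kappaOf]; linarith [hα.2]

theorem regularArg_eigenvalue (hα : α ∈ Ico (1 : ℝ) 2) (hℓ : 0 < ℓ) (y : ℝ) :
    ℓ ^ (α - 2) * kappaOf α ^ 2 * y ^ 2 * ℓ ^ (2 - α) / (2 - α) ^ 2 = y ^ 2 / 4 := by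
  have h : ℓ ^ (α - 2) * ℓ ^ (2 - α) = 1 := by
    rw [← Real.rpow_add hℓ, show α - 2 + (2 - α) = 0 by ring, Real.rpow_zero]
  have h2 : 2 - α ≠ 0 := by linarith [hα.2]
  rw [show ℓ ^ (α - 2) * kappaOf α ^ 2 * y ^ 2 * ℓ ^ (2 - α)
    = (ℓ ^ (α - 2) * ℓ ^ (2 - α)) * kappaOf α ^ 2 * y ^ 2 by ring, h, kappaOf]
  field_simp
  ring

theorem besselJ_eq_zero_iff_regularSol (hα : α ∈ Ico (1 : ℝ) 2) (hℓ : 0 < ℓ) (hy : 0 < y) :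
    besselJ (nuOf α) y = 0 ↔ regularSol α (ℓ ^ (α - 2) * kappaOf α ^ 2 * y ^ 2) ℓ = 0 := by
  rw [besselJ_eq_zero_iff (nuOf_nonneg hα) hy, regularSol, regularArg_eigenvalue hα hℓ]

/-- Simplicity of the Bessel zeros, read off from ODE uniqueness with `ℓ = 1`. -/
theorem besselEntire_succ_ne_zero (hα : α ∈ Ico (1 : ℝ) 2) (hy : 0 < y)
    (h : besselJ (nuOf α) y = 0) : besselEntire (nuOf α + 1) (y ^ 2 / 4) ≠ 0 := by
  have h1 := regularFlux_ne_zero hα one_pos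
    ((besselJ_eq_zero_iff_regularSol hα one_pos hy).1 h)
  rw [regularFlux, regularArg_eigenvalue hα one_pos] at h1
  exact fun h2 => h1 (by rw [h2]; ring)

theorem exists_eq_of_regularSol_eq_zero (hα : α ∈ Ico (1 : ℝ) 2) (hℓ : 0 < ℓ) {lam : ℝ}
    (h : regularSol α lam ℓ = 0) : ∃ y, (0 < y ∧ besselJ (nuOf α) y = 0) ∧
      lam = ℓ ^ (α - 2) * kappaOf α ^ 2 * y ^ 2 := by
  have hlam : 0 < lam := by
    by_contra! hl
    exact (regularSol_pos_of_nonpos hα hℓ hl).ne' h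
  have hκ := kappaOf_pos hα
  have hp : 0 < ℓ ^ (α - 2) * kappaOf α ^ 2 :=
    mul_pos (Real.rpow_pos_of_pos hℓ _) (by positivity)
  have hy : 0 < √(lam / (ℓ ^ (α - 2) * kappaOf α ^ 2)) := Real.sqrt_pos.2 (div_pos hlam hp)
  have he : lam = ℓ ^ (α - 2) * kappaOf α ^ 2 * √(lam / (ℓ ^ (α - 2) * kappaOf α ^ 2)) ^ 2 := by
    rw [Real.sq_sqrt (div_pos hlam hp).le, mul_div_cancel₀ _ hp.ne']
  refine ⟨_, ⟨hy, ?_⟩, he⟩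
  rw [besselJ_eq_zero_iff_regularSol hα hℓ hy, ← he]
  exact h

/-- An accumulation point would be a zero of `y ↦ g_ν(y²/4)` with vanishing derivative. Positive
points are excluded by simplicity, and `0` by `g_ν(0) > 0`. -/
theorem finite_besselJ_zeros (hα : α ∈ Ico (1 : ℝ) 2) (R : ℝ) :
    ({y : ℝ | 0 < y ∧ besselJ (nuOf α) y = 0} ∩ Iic R).Finite := by
  have hν := nuOf_nonneg hα
  by_contra hinf
  obtain ⟨x, hx, hacc⟩ := Set.Infinite.exists_accPt_of_subset_isCompact hinf
    (isCompact_Icc (a := (0 : ℝ)) (b := R)) fun y hy => ⟨hy.1.1.le, hy.2⟩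
  rw [accPt_iff_frequently_nhdsNE] at hacc
  have hfreq : ∃ᶠ y in 𝓝[≠] x, besselEntire (nuOf α) (y ^ 2 / 4) = 0 :=
    hacc.mono fun y hy => (besselJ_eq_zero_iff hν hy.1.1).1 hy.1.2
  have hd : HasDerivAt (fun y : ℝ => besselEntire (nuOf α) (y ^ 2 / 4))
      (-besselEntire (nuOf α + 1) (x ^ 2 / 4) * (2 * x / 4)) x := by
    have := (hasDerivAt_besselEntire hν (x ^ 2 / 4)).comp x ((hasDerivAt_pow 2 x).div_const 4)
    exact this.congr_deriv (by simp)
  by_cases h0 : besselEntire (nuOf α) (x ^ 2 / 4) = 0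
  · have hx0 : 0 < x := by
      refine lt_of_le_of_ne hx.1 fun h => ?_
      subst h
      exact (besselEntire_zero_pos hν).ne' (by simpa using h0)
    have hne := besselEntire_succ_ne_zero hα hx0 ((besselJ_eq_zero_iff hν hx0).2 h0)
    exact hfreq (hd.eventually_ne (mul_ne_zero (neg_ne_zero.2 hne) (by positivity)))
  · exact hfreq ((hd.continuousAt.eventually_ne h0).filter_mono nhdsWithin_le_nhds)

/-- With finitely many zeros, the span of the regular solutions is closed, hence all of `L²(0, ℓ)`.
Its elements have continuous representatives, but a step at `ℓ/2` has none. -/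
theorem infinite_regularSol_zeros (hα : α ∈ Ico (1 : ℝ) 2) (hℓ : 0 < ℓ) :
    {lam | regularSol α lam ℓ = 0}.Infinite := by
  intro hfin
  set P : Submodule ℝ (Lp ℝ 2 (intervalMeasure ℓ)) :=
    Submodule.span ℝ (regularSolLp hα ℓ '' {lam | regularSol α lam ℓ = 0}) with hP
  have : FiniteDimensional ℝ P := FiniteDimensional.span_of_finite ℝ (hfin.image _)
  have htop : P = ⊤ := (Submodule.orthogonal_eq_bot_iff).1 (span_regularSolLp_orthogonal hα hℓ)
  have hcont : ∀ f ∈ P, ∃ g : ℝ → ℝ, Continuous g ∧ f =ᵐ[intervalMeasure ℓ] g := by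
    intro f hf
    induction hf using Submodule.span_induction with
    | mem f hf =>
      obtain ⟨lam, -, rfl⟩ := hf
      exact ⟨_, continuous_regularSol hα lam, regularSolLp_ae hα ℓ lam⟩
    | zero => exact ⟨0, continuous_zero, Lp.coeFn_zero ℝ 2 (intervalMeasure ℓ)⟩
    | add f f' _ _ h h' =>
      obtain ⟨g, hg, hfg⟩ := h
      obtain ⟨g', hg', hfg'⟩ := h'
      exact ⟨g + g', hg.add hg', (Lp.coeFn_add f f').trans (hfg.add hfg')⟩
    | smul c f _ h =>
      obtain ⟨g, hg, hfg⟩ := h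
      exact ⟨c • g, hg.const_smul c, (Lp.coeFn_smul c f).trans (hfg.const_smul c)⟩
  obtain ⟨g, hg, hfg⟩ := hcont (stepLp ℓ (ℓ / 2)) (htop ▸ Submodule.mem_top)
  have hind : (Ioc 0 (ℓ / 2)).indicator (fun _ => (1 : ℝ)) =ᵐ[intervalMeasure ℓ] g :=
    indicatorConstLp_coeFn.symm.trans hfg
  have h1 : EqOn (fun _ => (1 : ℝ)) g (Ioo 0 (ℓ / 2)) := by
    refine Measure.eqOn_open_of_ae_eq (μ := volume) ?_ isOpen_Ioo continuousOn_const hg.continuousOn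
    filter_upwards [ae_restrict_of_ae_restrict_of_subset
      (Ioo_subset_Ioo_right (by linarith : ℓ / 2 ≤ ℓ)) hind,
      ae_restrict_mem measurableSet_Ioo] with x hx hx'
    rw [← hx, indicator_of_mem (Ioo_subset_Ioc_self hx')]
  have h2 : EqOn (fun _ => (0 : ℝ)) g (Ioo (ℓ / 2) ℓ) := by
    refine Measure.eqOn_open_of_ae_eq (μ := volume) ?_ isOpen_Ioo continuousOn_const hg.continuousOn
    filter_upwards [ae_restrict_of_ae_restrict_of_subset
      (Ioo_subset_Ioo_left (by linarith : 0 ≤ ℓ / 2)) hind,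
      ae_restrict_mem measurableSet_Ioo] with x hx hx'
    rw [← hx, indicator_of_notMem fun h => hx'.1.not_ge h.2]
  have h3 := h1.closure continuous_const hg
  have h4 := h2.closure continuous_const hg
  rw [closure_Ioo (by linarith)] at h3 h4
  have h5 := h3 (x := ℓ / 2) ⟨by linarith, le_rfl⟩
  have h6 := h4 (x := ℓ / 2) ⟨le_rfl, by linarith⟩
  simp only at h5 h6
  linarith

theorem infinite_besselJ_zeros (hα : α ∈ Ico (1 : ℝ) 2) :
    {y : ℝ | 0 < y ∧ besselJ (nuOf α) y = 0}.Infinite := by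
  intro hfin
  refine infinite_regularSol_zeros hα one_pos
    ((hfin.image fun y => (1 : ℝ) ^ (α - 2) * kappaOf α ^ 2 * y ^ 2).subset fun lam hlam => ?_)
  obtain ⟨y, hy, he⟩ := exists_eq_of_regularSol_eq_zero hα one_pos hlam
  exact ⟨y, hy, he.symm⟩

theorem besselZero_nonneg (ν : ℝ) (n : ℕ) : 0 ≤ besselZero ν n := by
  induction n with
  | zero => exact le_rfl
  | succ n ih => exact Real.sInf_nonneg fun y hy => ih.trans hy.1.le

theorem besselZero_enumerates (hα : α ∈ Ico (1 : ℝ) 2) :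
    StrictMono (besselZero (nuOf α)) ∧ {y : ℝ | 0 < y ∧ besselJ (nuOf α) y = 0}
      = {y | ∃ n : ℕ, 1 ≤ n ∧ y = besselZero (nuOf α) n} := by
  refine strictMono_and_eq_range_of_sInf (fun y hy => hy.1) (infinite_besselJ_zeros hα)
    (finite_besselJ_zeros hα) fun n => ?_
  rw [besselZero]
  congr 1
  ext y
  exact ⟨fun h => ⟨h.1, (besselZero_nonneg _ n).trans_lt h.1, h.2⟩, fun h => ⟨h.1, h.2.2⟩⟩

end Zeros

/-! ### Normalization and the orthonormal basis. -/

noncomputable section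
open MeasureTheory

section Main

variable {α ℓ : ℝ}

theorem inner_regularSolLp (hα : α ∈ Ico (1 : ℝ) 2) (hℓ : 0 < ℓ) (lam mu : ℝ) :
    inner ℝ (regularSolLp hα ℓ lam) (regularSolLp hα ℓ mu)
      = ∫ x in (0 : ℝ)..ℓ, regularSol α lam x * regularSol α mu x := by
  have h : (fun x => inner ℝ (regularSolLp hα ℓ lam x) (regularSolLp hα ℓ mu x))
      =ᵐ[intervalMeasure ℓ] fun x => regularSol α lam x * regularSol α mu x := by
    filter_upwards [regularSolLp_ae hα ℓ lam, regularSolLp_ae hα ℓ mu] with x h1 h2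
    rw [h1, h2, Real.inner_apply]
  rw [L2.inner_def, MeasureTheory.integral_congr_ae h, intervalIntegral.integral_of_le hℓ.le,
    integral_Ioc_eq_integral_Ioo]

/-- The factor with `Φ_{α,n} = c * regularSol α λ_{α,n}` on `(0, ∞)`. -/
def normalizingConst (α ℓ : ℝ) (n : ℕ) : ℝ :=
  √(2 * kappaOf α) / (ℓ ^ kappaOf α * |deriv (besselJ (nuOf α)) (besselZero (nuOf α) n)|) *
    ((besselZero (nuOf α) n / 2) ^ nuOf α * ℓ ^ ((1 - α) / 2))

theorem besselEigenfunction_eq (hα : α ∈ Ico (1 : ℝ) 2) (hℓ : 0 < ℓ) (n : ℕ) {x : ℝ} (hx : 0 < x) :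
    besselEigenfunction α ℓ n x
      = normalizingConst α ℓ n * regularSol α (besselEigenvalue α ℓ n) x := by
  have hj := besselZero_nonneg (nuOf α) n
  have h2 : 2 - α ≠ 0 := by linarith [hα.2]
  rw [besselEigenfunction, normalizingConst, regularSol, besselEigenvalue]
  set j := besselZero (nuOf α) n
  have hq : 0 ≤ (x / ℓ) ^ kappaOf α := Real.rpow_nonneg (by positivity) _
  rw [besselJ_eq (nuOf_nonneg hα) (mul_nonneg hj hq)]
  have hsq : ((x / ℓ) ^ kappaOf α) ^ 2 = x ^ (2 - α) * ℓ ^ (α - 2) := by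
    rw [← Real.rpow_natCast, ← Real.rpow_mul (by positivity), kappaOf,
      show (2 - α) / 2 * ((2 : ℕ) : ℝ) = 2 - α by push_cast; ring,
      Real.div_rpow hx.le hℓ.le, div_eq_mul_inv, ← Real.rpow_neg hℓ.le, neg_sub]
  have harg : (j * (x / ℓ) ^ kappaOf α) ^ 2 / 4
      = ℓ ^ (α - 2) * kappaOf α ^ 2 * j ^ 2 * x ^ (2 - α) / (2 - α) ^ 2 := by
    rw [mul_pow, hsq, kappaOf]; field_simp; ring
  have hpow : (j * (x / ℓ) ^ kappaOf α / 2) ^ nuOf α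
      = (j / 2) ^ nuOf α * ℓ ^ ((1 - α) / 2) * x ^ ((α - 1) / 2) := by
    rw [mul_div_right_comm, Real.mul_rpow (by positivity) hq, ← Real.rpow_mul (by positivity),
      show kappaOf α * nuOf α = (α - 1) / 2 by rw [kappaOf, nuOf]; field_simp,
      Real.div_rpow hx.le hℓ.le, div_eq_mul_inv (x ^ _), ← Real.rpow_neg hℓ.le,
      show -((α - 1) / 2) = (1 - α) / 2 by ring]
    ring
  have hx1 : x ^ ((1 - α) / 2) * x ^ ((α - 1) / 2) = 1 := by
    rw [← Real.rpow_add hx, show (1 - α) / 2 + (α - 1) / 2 = 0 by ring, Real.rpow_zero]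
  rw [harg, hpow]
  linear_combination (√(2 * kappaOf α) / (ℓ ^ kappaOf α * |deriv (besselJ (nuOf α)) j|)
    * (j / 2) ^ nuOf α * ℓ ^ ((1 - α) / 2) * besselEntire (nuOf α)
      (ℓ ^ (α - 2) * kappaOf α ^ 2 * j ^ 2 * x ^ (2 - α) / (2 - α) ^ 2)) * hx1

theorem besselZero_spec (hα : α ∈ Ico (1 : ℝ) 2) {n : ℕ} (hn : 1 ≤ n) :
    0 < besselZero (nuOf α) n ∧ besselJ (nuOf α) (besselZero (nuOf α) n) = 0 :=
  (besselZero_enumerates hα).2.superset ⟨n, hn, rfl⟩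

theorem regularSol_besselEigenvalue (hα : α ∈ Ico (1 : ℝ) 2) (hℓ : 0 < ℓ) {n : ℕ} (hn : 1 ≤ n) :
    regularSol α (besselEigenvalue α ℓ n) ℓ = 0 :=
  (besselJ_eq_zero_iff_regularSol hα hℓ (besselZero_spec hα hn).1).1 (besselZero_spec hα hn).2

theorem exists_eq_besselEigenvalue (hα : α ∈ Ico (1 : ℝ) 2) (hℓ : 0 < ℓ) {lam : ℝ}
    (h : regularSol α lam ℓ = 0) : ∃ n : ℕ, 1 ≤ n ∧ lam = besselEigenvalue α ℓ n := by
  obtain ⟨y, hy, rfl⟩ := exists_eq_of_regularSol_eq_zero hα hℓ h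
  obtain ⟨n, hn, rfl⟩ := (besselZero_enumerates hα).2.subset hy
  exact ⟨n, hn, rfl⟩

theorem besselEigenvalue_injective (hα : α ∈ Ico (1 : ℝ) 2) (hℓ : 0 < ℓ) :
    Function.Injective (besselEigenvalue α ℓ) := by
  intro m n h
  have hp : ℓ ^ (α - 2) * kappaOf α ^ 2 ≠ 0 :=
    mul_ne_zero (Real.rpow_pos_of_pos hℓ _).ne' (pow_ne_zero _ (kappaOf_pos hα).ne')
  have h2 := mul_left_cancel₀ hp h
  exact (besselZero_enumerates hα).1.injective
    ((pow_left_inj₀ (besselZero_nonneg _ _) (besselZero_nonneg _ _) two_ne_zero).1 h2)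

/-- Both `J_ν'(j)` and the flux at `ℓ` in the Rellich identity are multiples of `g_{ν+1}(j²/4) ≠ 0`,
which therefore cancels; only powers of `ℓ` and `j` remain to be matched. -/
theorem normalizingConst_sq_mul_integral (hα : α ∈ Ico (1 : ℝ) 2) (hℓ : 0 < ℓ) {n : ℕ}
    (hn : 1 ≤ n) :
    normalizingConst α ℓ n ^ 2
      * ∫ x in (0 : ℝ)..ℓ, regularSol α (besselEigenvalue α ℓ n) x ^ 2 = 1 := by
  obtain ⟨hj, hJ⟩ := besselZero_spec hα hn
  have hI := integral_regularSol_sq hα hℓ (regularSol_besselEigenvalue hα hℓ hn)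
  have hE := besselEntire_succ_ne_zero hα hj hJ
  have hκ := kappaOf_pos hα
  have h2 : 0 < 2 - α := by linarith [hα.2]
  set I := ∫ x in (0 : ℝ)..ℓ, regularSol α (besselEigenvalue α ℓ n) x ^ 2
  rw [regularFlux, besselEigenvalue, regularArg_eigenvalue hα hℓ] at hI
  rw [normalizingConst, deriv_besselJ_of_eq_zero (nuOf_nonneg hα) hj hJ, abs_neg]
  set j := besselZero (nuOf α) n
  set E := besselEntire (nuOf α + 1) (j ^ 2 / 4)
  set A := (j / 2) ^ nuOf α with hA
  have hA0 : A ≠ 0 := (Real.rpow_pos_of_pos (by positivity) _).ne'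
  have hp1 : 0 < ℓ ^ (α - 2) := Real.rpow_pos_of_pos hℓ _
  have hp2 : 0 < ℓ ^ kappaOf α := Real.rpow_pos_of_pos hℓ _
  have e1 : (ℓ ^ kappaOf α) ^ 2 * ℓ ^ (α - 2) = 1 := by
    rw [← Real.rpow_natCast, ← Real.rpow_mul hℓ.le, ← Real.rpow_add hℓ,
      show kappaOf α * ((2 : ℕ) : ℝ) + (α - 2) = 0 by rw [kappaOf]; push_cast; ring, Real.rpow_zero]
  have e2 : (ℓ ^ ((1 - α) / 2)) ^ 2 = ℓ ^ (1 - α) := by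
    rw [← Real.rpow_natCast, ← Real.rpow_mul hℓ.le]; congr 1; push_cast; ring
  have e3 : ℓ ^ (1 - α) * ℓ = (ℓ ^ kappaOf α) ^ 2 := by
    rw [← Real.rpow_natCast, ← Real.rpow_mul hℓ.le, ← Real.rpow_add_one hℓ.ne']
    congr 1; rw [kappaOf]; push_cast; ring
  have e4 : √(2 * kappaOf α) ^ 2 = 2 - α := by
    rw [Real.sq_sqrt (by positivity), kappaOf]; ring
  set K := ℓ ^ kappaOf α
  set a := ℓ ^ (α - 2)
  set L := ℓ ^ (1 - α)
  have h3 : (2 - α) * I = L * ℓ ^ 2 * a * j ^ 2 * E ^ 2 / 4 := by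
    have hne : a * kappaOf α ^ 2 * j ^ 2 ≠ 0 := by positivity
    refine mul_left_cancel₀ hne ?_
    rw [show a * kappaOf α ^ 2 * j ^ 2 * ((2 - α) * I)
      = (2 - α) * (a * kappaOf α ^ 2 * j ^ 2) * I by ring, hI, kappaOf]
    field_simp
    norm_num
  have h4 : 4 * (2 - α) * L * I = K ^ 2 * E ^ 2 * j ^ 2 := by
    calc 4 * (2 - α) * L * I = 4 * L * ((2 - α) * I) := by ring
      _ = (L * ℓ) ^ 2 * a * j ^ 2 * E ^ 2 := by rw [h3]; ring
      _ = K ^ 2 * (K ^ 2 * a) * j ^ 2 * E ^ 2 := by rw [e3]; ring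
      _ = _ := by rw [e1]; ring
  have h5 : K ^ 2 * E ^ 2 * j ^ 2 ≠ 0 := by positivity
  have h6 : (√(2 * kappaOf α) / (K * |A * E * (j / 2)|) * (A * ℓ ^ ((1 - α) / 2))) ^ 2
      = 4 * (2 - α) * L / (K ^ 2 * E ^ 2 * j ^ 2) := by
    rw [mul_pow, div_pow, mul_pow, mul_pow, sq_abs, e4, e2]
    field_simp
    ring
  rw [h6, div_mul_eq_mul_div, h4, div_self h5]

theorem norm_normalizingConst_smul (hα : α ∈ Ico (1 : ℝ) 2) (hℓ : 0 < ℓ) {n : ℕ} (hn : 1 ≤ n) :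
    ‖normalizingConst α ℓ n • regularSolLp hα ℓ (besselEigenvalue α ℓ n)‖ = 1 := by
  rw [← sq_eq_sq₀ (norm_nonneg _) zero_le_one, norm_smul, mul_pow,
    ← real_inner_self_eq_norm_sq (regularSolLp hα ℓ (besselEigenvalue α ℓ n)),
    inner_regularSolLp hα hℓ, Real.norm_eq_abs, sq_abs, one_pow]
  simpa only [sq] using normalizingConst_sq_mul_integral hα hℓ hn

theorem normalizingConst_ne_zero (hα : α ∈ Ico (1 : ℝ) 2) (hℓ : 0 < ℓ) {n : ℕ} (hn : 1 ≤ n) :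
    normalizingConst α ℓ n ≠ 0 := by
  intro h
  have := norm_normalizingConst_smul hα hℓ hn
  simp [h] at this

theorem smul_regularSolLp_ae (hα : α ∈ Ico (1 : ℝ) 2) {lam c : ℝ} {Φ : ℝ → ℝ}
    (h : ∀ x ∈ Ioc 0 ℓ, Φ x = c * regularSol α lam x) :
    (c • regularSolLp hα ℓ lam : Lp ℝ 2 (intervalMeasure ℓ)) =ᵐ[intervalMeasure ℓ] Φ := by
  filter_upwards [regularSolLp_ae hα ℓ lam, Lp.coeFn_smul c (regularSolLp hα ℓ lam),
    ae_restrict_mem measurableSet_Ioo] with x h1 h2 h3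
  rw [h2, Pi.smul_apply, h1, h x (Ioo_subset_Ioc_self h3), smul_eq_mul]

theorem eLpNorm_eq_one_iff (hα : α ∈ Ico (1 : ℝ) 2) {lam c : ℝ} {Φ : ℝ → ℝ}
    (h : ∀ x ∈ Ioc 0 ℓ, Φ x = c * regularSol α lam x) :
    eLpNorm Φ 2 (intervalMeasure ℓ) = 1 ↔ ‖c • regularSolLp hα ℓ lam‖ = 1 := by
  rw [← eLpNorm_congr_ae (smul_regularSolLp_ae hα h), ← Lp.enorm_def, enorm_eq_nnnorm,
    ENNReal.coe_eq_one, ← NNReal.coe_eq_one, coe_nnnorm]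

theorem orthonormal_normalizingConst_smul (hα : α ∈ Ico (1 : ℝ) 2) (hℓ : 0 < ℓ) :
    Orthonormal ℝ fun n : ℕ+ =>
      normalizingConst α ℓ n • regularSolLp hα ℓ (besselEigenvalue α ℓ n) := by
  refine ⟨fun n => norm_normalizingConst_smul hα hℓ n.2, fun m n hmn => ?_⟩
  have hne : besselEigenvalue α ℓ m ≠ besselEigenvalue α ℓ n := fun h =>
    hmn (PNat.coe_injective (besselEigenvalue_injective hα hℓ h))
  simp only [real_inner_smul_left, real_inner_smul_right]
  rw [inner_regularSolLp hα hℓ, integral_regularSol_mul_eq_zero hα hℓ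
    (regularSol_besselEigenvalue hα hℓ m.pos) (regularSol_besselEigenvalue hα hℓ n.pos) hne]
  simp

theorem span_normalizingConst_smul_orthogonal (hα : α ∈ Ico (1 : ℝ) 2) (hℓ : 0 < ℓ) :
    (Submodule.span ℝ (range fun n : ℕ+ =>
      normalizingConst α ℓ n • regularSolLp hα ℓ (besselEigenvalue α ℓ n)))ᗮ = ⊥ := by
  rw [eq_bot_iff, ← span_regularSolLp_orthogonal hα hℓ]
  refine Submodule.orthogonal_le (Submodule.span_le.2 ?_)
  rintro _ ⟨lam, hlam, rfl⟩
  obtain ⟨n, hn, rfl⟩ := exists_eq_besselEigenvalue hα hℓ hlam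
  rw [← inv_smul_smul₀ (normalizingConst_ne_zero hα hℓ hn) (regularSolLp hα ℓ _)]
  exact Submodule.smul_mem _ _ (Submodule.subset_span ⟨⟨n, hn⟩, rfl⟩)

theorem isEigenfunction_besselEigenfunction (hα : α ∈ Ico (1 : ℝ) 2) (hℓ : 0 < ℓ) {n : ℕ}
    (hn : 1 ≤ n) :
    IsEigenfunction α ℓ (besselEigenvalue α ℓ n) (besselEigenfunction α ℓ n) :=
  isEigenfunction_of_eqOn hα hℓ (regularSol_besselEigenvalue hα hℓ hn)
    (normalizingConst_ne_zero hα hℓ hn) fun _ hx => besselEigenfunction_eq hα hℓ n hx.1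

theorem eqOn_besselEigenfunction_or_neg (hα : α ∈ Ico (1 : ℝ) 2) (hℓ : 0 < ℓ) {n : ℕ} (hn : 1 ≤ n)
    {Φ : ℝ → ℝ} (h : IsEigenfunction α ℓ (besselEigenvalue α ℓ n) Φ)
    (hΦ : eLpNorm Φ 2 (intervalMeasure ℓ) = 1) :
    EqOn Φ (besselEigenfunction α ℓ n) (Ioc 0 ℓ) ∨
      EqOn Φ (-besselEigenfunction α ℓ n) (Ioc 0 ℓ) := by
  obtain ⟨-, c, hc⟩ := h.eq_const_mul hα hℓ
  have h1 := (eLpNorm_eq_one_iff hα hc).1 hΦ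
  have h2 := norm_normalizingConst_smul hα hℓ hn
  rw [norm_smul] at h1 h2
  have h3 : ‖regularSolLp hα ℓ (besselEigenvalue α ℓ n)‖ ≠ 0 := right_ne_zero_of_mul_eq_one h1
  have h4 : |c| = |normalizingConst α ℓ n| := mul_right_cancel₀ h3 (h1.trans h2.symm)
  rcases abs_eq_abs.1 h4 with h5 | h5
  · exact Or.inl fun x hx => by rw [hc x hx, besselEigenfunction_eq hα hℓ n hx.1, h5]
  · refine Or.inr fun x hx => ?_
    rw [hc x hx, Pi.neg_apply, besselEigenfunction_eq hα hℓ n hx.1, h5, neg_mul]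

end Main
end

theorem mainTheorem6 (α ℓ : ℝ) (hα : α ∈ Set.Ico (1 : ℝ) 2) (hℓ : 0 < ℓ) :
    -- the numbers `j_{ν_α,n}`, `n ≥ 1`, enumerate the positive zeros of `J_{ν_α}` increasingly
    (StrictMono (besselZero (nuOf α)) ∧
      {y : ℝ | 0 < y ∧ besselJ (nuOf α) y = 0} = {y | ∃ n : ℕ, 1 ≤ n ∧ y = besselZero (nuOf α) n}) ∧
    -- the eigenvalues
    {lam : ℝ | IsEigenvalue α ℓ lam} = {lam | ∃ n : ℕ, 1 ≤ n ∧ lam = besselEigenvalue α ℓ n} ∧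
    -- the normalized eigenfunctions: `Φ_{α,n}` is one, and it is the only one up to sign
    (∀ n : ℕ, 1 ≤ n →
      IsEigenfunction α ℓ (besselEigenvalue α ℓ n) (besselEigenfunction α ℓ n) ∧
      MeasureTheory.eLpNorm (besselEigenfunction α ℓ n) 2 (intervalMeasure ℓ) = 1 ∧
      ∀ Φ : ℝ → ℝ, IsEigenfunction α ℓ (besselEigenvalue α ℓ n) Φ →
        MeasureTheory.eLpNorm Φ 2 (intervalMeasure ℓ) = 1 →
        Set.EqOn Φ (besselEigenfunction α ℓ n) (Set.Ioc 0 ℓ) ∨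
          Set.EqOn Φ (-besselEigenfunction α ℓ n) (Set.Ioc 0 ℓ)) ∧
    -- they form an orthonormal (Hilbert) basis of `L²(0, ℓ)`
    ∃ b : HilbertBasis ℕ+ ℝ (MeasureTheory.Lp ℝ 2 (intervalMeasure ℓ)),
      ∀ n : ℕ+, b n =ᵐ[intervalMeasure ℓ] besselEigenfunction α ℓ n := by
  refine ⟨besselZero_enumerates hα, ?_, fun n hn =>
    ⟨isEigenfunction_besselEigenfunction hα hℓ hn, ?_, fun Φ h hΦ =>
      eqOn_besselEigenfunction_or_neg hα hℓ hn h hΦ⟩, ?_⟩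
  · ext lam
    constructor
    · rintro ⟨Φ, h⟩
      exact exists_eq_besselEigenvalue hα hℓ (h.eq_const_mul hα hℓ).1
    · rintro ⟨n, hn, rfl⟩
      exact ⟨_, isEigenfunction_besselEigenfunction hα hℓ hn⟩
  · exact (eLpNorm_eq_one_iff hα fun x hx => besselEigenfunction_eq hα hℓ n hx.1).2
      (norm_normalizingConst_smul hα hℓ hn)
  · refine ⟨HilbertBasis.mkOfOrthogonalEqBot (orthonormal_normalizingConst_smul hα hℓ)
      (span_normalizingConst_smul_orthogonal hα hℓ), fun n => ?_⟩
    rw [HilbertBasis.coe_mkOfOrthogonalEqBot]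
    exact smul_regularSolLp_ae hα fun x hx => besselEigenfunction_eq hα hℓ n hx.1
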